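/- Let $\Bbbk$ be an algebraically closed field of characteristic zero, let $R=\Bbbk[x_0,\dots,x_n]$, and let $R_d$ be the space of forms of degree $d$ in $R$. For a tuple $\mathbf f=(\ell_1,\dots,\ell_r)$ of linear forms write $\pi_m(\mathbf f)=\prod_{i\ne m}\ell_i$. For integers $n,d\ge 1$ and $s,t,u,v\ge 0$ choose generic tuples of linear forms $\mathbf f_j\in R_1^{d}$ ($1\le j\le s$), $\mathbf f'_j\in R_1^{d+1}$ ($1\le j\le t$), $\mathbf f''_j\in R_1^{d+1}$ ($1\le j\le u$), $\mathbf f'''_j\in R_1^{d}$ ($1\le j\le v$), and put $$A(n,d,s,t,u,v)=\sum_{j=1}^{s}\sum_{m=1}^{d}\pi_m(\mathbf f_j)R_1+\sum_{j=1}^{t}\langle\pi_1(\mathbf f'_j)\rangle+\sum_{j=1}^{u}\sum_{m=1}^{d+1}\langle\pi_m(\mathbf f''_j)\rangle+\sum_{j=1}^{v}\pi_1(\mathbf f'''_j)R_1\subseteq R_d,$$ $$a(n,d,s,t,u,v)=(dn+1)s+t+(d+1)u+(n+1)v.$$ The statement $\mathbb A(n,d,s,t,u,v)$ is called true if $\dim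 A(n,d,s,t,u,v)=\min\{a(n,d,s,t,u,v),\binom{n+d}{d}\}$ for a generic choice of the tuples (that is, for all choices in some Zariski open dense set), and subabundant if $a(n,d,s,t,u,v)\le\binom{n+d}{d}$. Let $\mathrm{Split}_d(\mathbb P^n)\subset\mathbb P R_d$ be the variety of classes of nonzero forms that are products of $d$ linear forms. For a projective variety $X\subset\mathbb P^N$ let $\sigma_s(X)$ be its $s$-th secant variety, the Zariski closure of the union of the linear spans of $s$ points of $X$; it is nondefective if its dimension is not less than $\min\{s(\dim X+1)-1,N\}$. Theorem (splitting induction). Let $n\ge 2$ and $d\ge 3$, and let $s=s'+s''$, $t=t'+t''$, $u=u'+u''$, $v=v'+v''$ with nonnegative integers $s',s'',\dots,v',v''$. If $\mathbb A(n-1,d,s'',t''+u',u'',s'+v'')$, $\mathbb A(n-1,d-1,s',t'+v'',s''+u',v')$ and $\mathbb A(n-1,d-2,0,v',s',0)$ are all true and subabundant, then $\mathbb A(n,d,s,t,u,v)$ is true and subabundant. In particular, if moreover $t=u=v=0$, then $\sigma_s(\mathrm{Split}_d(\mathbb P^n))$ is nondefective. -/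

import Mathlib

open scoped LinearAlgebra.Projectivization Topology

noncomputable section

namespace SplittingInduction

/-! ### Zariski topology, generic points, dimension

Throughout, `V` is meant to be a finite-dimensional vector space over the field `k`. A polynomial
function on `V` is given by a polynomial whose variables are the linear functionals on `V`. -/

section Geometry

variable (k : Type*) [Field k] (V : Type*) [AddCommGroup V] [Module k V]

/-- Polynomials in the linear functionals on `V`. -/
abbrev Poly : Type _ := MvPolynomial (Module.Dual k V) k

variable {k V}

/-- The value of such a polynomial at a vector `x`: the variable `φ` takes the value `φ x`. -/
def Poly.value (F : Poly k V) (x : V) : k :=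
  MvPolynomial.eval (fun φ : Module.Dual k V => φ x) F

variable (k V)

/-- The Zariski topology on the affine space `V`: generated by the sets `F ≠ 0`, with `F` a
polynomial. -/
abbrev affineZariski : TopologicalSpace V :=
  TopologicalSpace.generateFrom {U | ∃ F : Poly k V, U = {x | F.value x ≠ 0}}

/-- The Zariski topology on the projective space `ℙ k V`: generated by the sets `F ≠ 0`, with `F` a
homogeneous polynomial. -/
abbrev projectiveZariski : TopologicalSpace (ℙ k V) :=
  TopologicalSpace.generateFrom
    {U | ∃ (F : Poly k V) (e : ℕ), F.IsHomogeneous e ∧ U = {p | F.value p.rep ≠ 0}}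

variable {V}

/-- The property `P` holds for a generic point of the affine space `V`: the set of the points for
which it holds contains a Zariski open dense subset. -/
def Generic (P : V → Prop) : Prop :=
  ∃ U : Set V, IsOpen[affineZariski k V] U ∧ @Dense V (affineZariski k V) U ∧ ∀ x ∈ U, P x

/-- The ideal of all polynomials that vanish on the subset `Z` of `V`. -/
def vanishingIdeal (Z : Set V) : Ideal (Poly k V) where
  carrier := {F | ∀ x ∈ Z, F.value x = 0}
  add_mem' := by
    intro F G hF hG x hx
    have h1 : MvPolynomial.eval (fun φ : Module.Dual k V => φ x) F = 0 := hF x hx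
    have h2 : MvPolynomial.eval (fun φ : Module.Dual k V => φ x) G = 0 := hG x hx
    simp [Poly.value, h1, h2]
  zero_mem' := by
    intro x _
    simp [Poly.value]
  smul_mem' := by
    intro c F hF x hx
    have h1 : MvPolynomial.eval (fun φ : Module.Dual k V => φ x) F = 0 := hF x hx
    simp [Poly.value, h1]

/-- The coordinate ring of (the Zariski closure of) the subset `Z` of `V`. -/
abbrev CoordinateRing (Z : Set V) : Type _ := Poly k V ⧸ vanishingIdeal k Z

/-- The dimension of (the Zariski closure of) a nonempty subset `Z` of `V`: the Krull dimension of
its coordinate ring, a natural number when `V` is finite-dimensional. -/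
def affineDim (Z : Set V) : ℕ :=
  ((ringKrullDim (CoordinateRing k Z)).unbotD 0).toNat

variable {k}

/-- The affine cone of a subset `X` of projective space, with the origin included. -/
def affineCone (X : Set (ℙ k V)) : Set V :=
  {x | x = 0 ∨ ∃ hx : x ≠ 0, Projectivization.mk k x hx ∈ X}

/-- The dimension of (the Zariski closure of) a subset `X` of projective space, one less than the
dimension of the affine cone; the empty set has dimension `-1`. -/
def projDim (X : Set (ℙ k V)) : ℤ :=
  (affineDim k (affineCone X) : ℤ) - 1

/-! ### Secant varieties -/

/-- The linear span of finitely many points of projective space. -/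
def linearSpan {s : ℕ} (p : Fin s → ℙ k V) : Set (ℙ k V) :=
  {q | q.submodule ≤ ⨆ i, (p i).submodule}

/-- The `s`-th secant variety of `X`: the Zariski closure of the union of the linear spans of `s`
points of `X`. -/
def secantVariety (s : ℕ) (X : Set (ℙ k V)) : Set (ℙ k V) :=
  @closure (ℙ k V) (projectiveZariski k V)
    (⋃ (p : Fin s → ℙ k V) (_ : ∀ i, p i ∈ X), linearSpan p)

/-- The expected dimension `min {s (dim X + 1) - 1, N}` of the `s`-th secant variety of `X`, where
`N = dim V - 1` is the dimension of the projective space `ℙ k V`. -/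
def expectedDim (s : ℕ) (X : Set (ℙ k V)) : ℤ :=
  min ((s : ℤ) * (projDim X + 1) - 1) ((Module.finrank k V : ℤ) - 1)

/-- The `s`-th secant variety of `X` is defective if its dimension is less than expected. -/
def SecantDefective (s : ℕ) (X : Set (ℙ k V)) : Prop :=
  projDim (secantVariety s X) < expectedDim s X

/-- The `s`-th secant variety of `X` is nondefective if it is not defective. -/
def SecantNondefective (s : ℕ) (X : Set (ℙ k V)) : Prop :=
  ¬ SecantDefective s X

end Geometry

/-! ### Completely decomposable forms -/

section Forms

variable (k : Type*) [Field k]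

/-- The space `R_d` of forms of degree `d` in `R = k[x_0, …, x_n]`. -/
abbrev Form (n d : ℕ) : Submodule k (MvPolynomial (Fin (n + 1)) k) :=
  MvPolynomial.homogeneousSubmodule (Fin (n + 1)) k d

/-- The variety `Split_d(ℙ^n)` of completely decomposable forms, in the projective space of the
forms of degree `d`: the classes of the nonzero forms that are products of `d` linear forms. -/
def Split (n d : ℕ) : Set (ℙ k (Form k n d)) :=
  {p | ∃ (f : Form k n d) (hf : f ≠ 0), p = Projectivization.mk k f hf ∧
    ∃ l : Fin d → Form k n 1, (f : MvPolynomial (Fin (n + 1)) k) = ∏ i, (l i).1}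

variable {k}

/-- The product of all entries of the tuple `f` of linear forms but the one at position `m`.
Positions are counted from `0`. -/
def omitProd {n r : ℕ} (m : ℕ) (f : Fin r → Form k n 1) : MvPolynomial (Fin (n + 1)) k :=
  ∏ i ∈ Finset.univ.filter (fun i : Fin r => (i : ℕ) ≠ m), (f i).1

/-- The space `g R_1` of all products of `g` with a linear form. -/
def mulLinear {n : ℕ} (g : MvPolynomial (Fin (n + 1)) k) :
    Submodule k (MvPolynomial (Fin (n + 1)) k) :=
  (Form k n 1).map (LinearMap.mulLeft k g)

variable (k)

/-- The affine space of the tuples of linear forms from which `A(n,d,s,t,u,v)` is built: `s` tuples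
of length `d`, `t` and `u` tuples of length `d + 1`, and `v` tuples of length `d`. -/
abbrev Tuples (n d s t u v : ℕ) : Type _ :=
  (Fin s → Fin d → Form k n 1) × (Fin t → Fin (d + 1) → Form k n 1) ×
    (Fin u → Fin (d + 1) → Form k n 1) × (Fin v → Fin d → Form k n 1)

variable {k}

/-- The space `A(n,d,s,t,u,v)` for a given choice of the tuples of linear forms, a subspace of `R_d`
when `d ≥ 1`:
`∑_j ∑_m π_m(f_j) R_1 + ∑_j ⟨π_1(f'_j)⟩ + ∑_j ∑_m ⟨π_m(f''_j)⟩ + ∑_j π_1(f'''_j) R_1`. -/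
def spaceA {n d s t u v : ℕ} (f : Tuples k n d s t u v) :
    Submodule k (MvPolynomial (Fin (n + 1)) k) :=
  (⨆ j : Fin s, ⨆ m : Fin d, mulLinear (omitProd m (f.1 j))) ⊔
  (⨆ j : Fin t, Submodule.span k {omitProd 0 (f.2.1 j)}) ⊔
  (⨆ j : Fin u, ⨆ m : Fin (d + 1), Submodule.span k {omitProd m (f.2.2.1 j)}) ⊔
  (⨆ j : Fin v, mulLinear (omitProd 0 (f.2.2.2 j)))

/-- The number `a(n,d,s,t,u,v)`. -/
def expA (n d s t u v : ℕ) : ℕ :=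
  (d * n + 1) * s + t + (d + 1) * u + (n + 1) * v

variable (k)

/-- The statement `A(n,d,s,t,u,v)` is true: for a generic choice of the linear forms, the space
`A(n,d,s,t,u,v)` has dimension `min {a(n,d,s,t,u,v), binom(n+d,d)}`. -/
def IsTrue (n d s t u v : ℕ) : Prop :=
  Generic k (fun f : Tuples k n d s t u v =>
    Module.finrank k (spaceA f) = min (expA n d s t u v) ((n + d).choose d))

/-- The statement `A(n,d,s,t,u,v)` is subabundant. -/
def IsSubabundant (n d s t u v : ℕ) : Prop :=
  expA n d s t u v ≤ (n + d).choose d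

end Forms

end SplittingInduction

end

open SplittingInduction

/-! The dimension of `spaceA f` never exceeds `expA`, and rank is lower semicontinuous. In the
subabundant case it therefore suffices to exhibit one choice of linear forms for which the dimension
reaches `expA` (`isTrue_of_exists`). Such a choice is found by specialization. Some linear forms are
set equal to `x_0`, namely the first entry in the `s'` and `u'` tuples and the first two in the `t'`
and `v'` tuples. All other forms are taken free of `x_0`.

The specialized space then contains a direct sum `A_0 ⊕ x_0 A_1 ⊕ x_0² A_2`, where the `A_i` are
spaces of the same kind in one variable fewer and in degrees `d`, `d - 1`, `d - 2`. For instance, an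
unspecialized `s''` tuple gives `π_m R'_1` in layer 0 and `x_0 π_m` in layer 1, with `R'_1` the
linear forms free of `x_0`. An `s'` tuple gives `π_1 R'_1` in layer 0, and its tail `g` gives `x_0
π_m(g) R'_1` and `x_0² π_m(g)`. The three hypotheses speak of exactly these layers. Each set of
layer tuples depends linearly and surjectively on the chosen tuples, so one choice is generic for
all three, and the numbers `expA` of the layers add up to the wanted one (`expA_layers`,
`finrank_layers_le`). Subabundance adds up by Pascal's rule.

For the secant variety, `spaceA` with `t = u = v = 0` is the image of the differential of the map
sending `s` tuples to the sum of their products. In characteristic zero the Jacobian criterion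
bounds the dimension of the closure of the image below by this rank, which is `s(dn+1)`
(`finrank_spaceA_le_affineDim`). The image lies in the cone over the secant variety, while the cone
over `Split` has dimension at most `dn+1`, since a dense part of it is parametrized by a scalar and
`d` normalized linear forms. Comparing the two bounds gives nondefectivity. -/

noncomputable section

namespace SplittingInduction

/-! ### Krull dimension of finitely generated algebras over a field -/

section KrullDimension

/-- An injective integral extension preserves the Krull dimension. -/
theorem ringKrullDim_eq_of_isIntegral_of_injective {A B : Type*} [CommRing A] [CommRing B]
    (f : A →+* B) (hf : Function.Injective f) (hi : f.IsIntegral) :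
    ringKrullDim B = ringKrullDim A := by
  let := f.toAlgebra
  have : Algebra.IsIntegral A B := ⟨hi⟩
  have : FaithfulSMul A B := (faithfulSMul_iff_algebraMap_injective A B).mpr hf
  apply le_antisymm
  -- Incomparability: contraction of primes along an integral extension preserves strict inclusions.
  · refine Order.krullDim_le_of_strictMono (PrimeSpectrum.comap (algebraMap A B)) ?_
    intro P Q hPQ
    exact Ideal.IsIntegral.comap_lt_comap (R := A) (I := P.asIdeal) (J := Q.asIdeal) hPQ
  -- Lying over provides a prime above the bottom of the chain, and going up lifts the rest.
  · refine iSup_le fun l => ?_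
    obtain ⟨⟨P, hP, hl⟩⟩ := Ideal.nonempty_primesOver (S := B) l.head.asIdeal
    obtain ⟨L, hL, -⟩ := Ideal.exists_ltSeries_of_hasGoingUp l P
    rw [← hL]
    exact Order.LTSeries.length_le_krullDim L

variable {k : Type*} [Field k] {C : Type*} [CommRing C] [Algebra k C]

/-- The Krull dimension of a polynomial ring in `r` variables over a field. -/
theorem ringKrullDim_mvPolynomial_fin (r : ℕ) :
    ringKrullDim (MvPolynomial (Fin r) k) = (r : WithBot ℕ∞) := by
  rw [MvPolynomial.ringKrullDim_of_isNoetherianRing, ringKrullDim_eq_zero_of_field]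
  simp

/-- Noether normalization with the number of variables identified as the Krull dimension. -/
theorem exists_noether_normalization_ringKrullDim [Nontrivial C] [Algebra.FiniteType k C] :
    ∃ (r : ℕ) (g : MvPolynomial (Fin r) k →ₐ[k] C), Function.Injective g ∧ g.IsIntegral ∧
      ringKrullDim C = (r : WithBot ℕ∞) := by
  obtain ⟨r, g, hg, hi⟩ := exists_integral_inj_algHom_of_fg k C
  refine ⟨r, g, hg, hi, ?_⟩
  rw [ringKrullDim_eq_of_isIntegral_of_injective g.toRingHom hg hi, ringKrullDim_mvPolynomial_fin]

/-- The Krull dimension of a finitely generated subalgebra of a polynomial ring is at most the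
number of variables. -/
theorem ringKrullDim_le_card_of_injective [Nontrivial C] [Algebra.FiniteType k C] {ι : Type*}
    [Fintype ι] (h : C →ₐ[k] MvPolynomial ι k) (hh : Function.Injective h) :
    ringKrullDim C ≤ (Fintype.card ι : WithBot ℕ∞) := by
  obtain ⟨r, g, hg, -, hr⟩ := exists_noether_normalization_ringKrullDim (k := k) (C := C)
  have := lift_trdeg_le_of_injective (h.comp g) (hh.comp hg)
  rw [MvPolynomial.trdeg_of_isDomain, MvPolynomial.trdeg_of_isDomain] at this
  simp only [Cardinal.lift_natCast, Cardinal.mk_fintype, Nat.cast_le, Fintype.card_fin] at this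
  rw [hr]
  exact_mod_cast this

/-- The Krull dimension of a finitely generated domain is at least the size of any algebraically
independent family. -/
theorem le_ringKrullDim_of_algebraicIndependent [IsDomain C] [Algebra.FiniteType k C] {a : ℕ}
    {y : Fin a → C} (hy : AlgebraicIndependent k y) : (a : WithBot ℕ∞) ≤ ringKrullDim C := by
  obtain ⟨r, g, hg, hi, hr⟩ := exists_noether_normalization_ringKrullDim (k := k) (C := C)
  have h1 := hy.lift_cardinalMk_le_trdeg
  have hx : AlgebraicIndependent k (fun i => g (MvPolynomial.X i)) :=
    (MvPolynomial.algebraicIndependent_X (Fin r) k).map' hg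
  have hb : IsTranscendenceBasis k (fun i => g (MvPolynomial.X i)) := by
    rw [hx.isTranscendenceBasis_iff_isAlgebraic]
    have hrange : ∀ p, g p ∈ Algebra.adjoin k (Set.range fun i => g (MvPolynomial.X i)) := by
      intro p
      rw [Algebra.adjoin_range_eq_range_aeval]
      refine ⟨p, ?_⟩
      exact (DFunLike.congr_fun (MvPolynomial.aeval_unique g) p).symm
    -- Every element of `C` is integral over the image of `g`, which is the algebra generated by the
    -- `g (X i)`.
    constructor
    intro c
    obtain ⟨p, hp, hpc⟩ := hi c
    refine IsIntegral.isAlgebraic ⟨p.map (RingHom.codRestrict g.toRingHom _ hrange), hp.map _, ?_⟩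
    rw [Polynomial.eval₂_map]
    exact hpc
  have h2 := hb.lift_cardinalMk_eq_trdeg
  simp only [Cardinal.mk_fin, Cardinal.lift_natCast] at h1 h2
  have h3 : (a : Cardinal) ≤ r := by
    rw [h2]
    simpa using h1
  rw [hr]
  exact_mod_cast h3

end KrullDimension

/-! ### Polynomial functions, generic properties and semicontinuity of rank -/

section PolynomialFunctions

variable {k : Type*} [Field k] {V : Type*} [AddCommGroup V] [Module k V]

@[simp] theorem Poly.value_mul (F G : Poly k V) (x : V) :
    Poly.value (F * G) x = F.value x * G.value x := map_mul _ F G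

@[simp] theorem Poly.value_add (F G : Poly k V) (x : V) :
    Poly.value (F + G) x = F.value x + G.value x := map_add _ F G

@[simp] theorem Poly.value_C (c : k) (x : V) :
    Poly.value (V := V) (MvPolynomial.C c) x = c := MvPolynomial.eval_C c

@[simp] theorem Poly.value_X (φ : Module.Dual k V) (x : V) :
    Poly.value (V := V) (MvPolynomial.X φ) x = φ x := MvPolynomial.eval_X φ

/-- Restriction of a polynomial function to a line. -/
theorem Poly.exists_restrict_line (F : Poly k V) (x y : V) :
    ∃ p : Polynomial k, ∀ t, p.eval t = F.value (x + t • y) := by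
  refine ⟨MvPolynomial.aeval (fun φ : Module.Dual k V =>
    Polynomial.C (φ x) + Polynomial.X * Polynomial.C (φ y)) F, fun t => ?_⟩
  rw [← Polynomial.coe_evalRingHom, MvPolynomial.aeval_def, MvPolynomial.hom_eval₂]
  unfold Poly.value MvPolynomial.eval
  simp only [MvPolynomial.coe_eval₂Hom]
  congr 1
  · ext; simp
  · funext φ
    simpa using mul_comm _ _

/-- The composition of a polynomial with a map whose components are polynomials. -/
theorem Poly.exists_comp {W : Type*} [AddCommGroup W] [Module k W] {g : W → V}
    (hg : ∀ φ : Module.Dual k V, ∃ G : Poly k W, ∀ x, G.value x = φ (g x)) (F : Poly k V) :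
    ∃ H : Poly k W, ∀ x, H.value x = F.value (g x) := by
  choose G hG using hg
  refine ⟨MvPolynomial.aeval G F, fun x => ?_⟩
  rw [Poly.value, MvPolynomial.aeval_def, MvPolynomial.hom_eval₂]
  change _ = MvPolynomial.eval₂ _ _ F
  congr 1
  · ext; simp
  · funext φ
    exact hG φ x

/-- Two polynomials that are somewhere nonzero have a common nonzero point. -/
theorem Poly.exists_value_ne_zero_and [Infinite k] {F G : Poly k V} {x y : V}
    (hF : F.value x ≠ 0) (hG : G.value y ≠ 0) : ∃ z, F.value z ≠ 0 ∧ G.value z ≠ 0 := by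
  obtain ⟨p, hp⟩ := F.exists_restrict_line x (y - x)
  obtain ⟨q, hq⟩ := G.exists_restrict_line x (y - x)
  have hp0 : p ≠ 0 := by
    rintro rfl
    exact hF (by simpa using (hp 0).symm)
  have hq0 : q ≠ 0 := by
    rintro rfl
    exact hG (by simpa using (hq 1).symm)
  obtain ⟨t, ht⟩ : ∃ t, (p * q).eval t ≠ 0 := by
    by_contra! h
    exact mul_ne_zero hp0 hq0 (Polynomial.funext (by simpa using h))
  rw [Polynomial.eval_mul, hp, hq] at ht
  exact ⟨_, left_ne_zero_of_mul ht, right_ne_zero_of_mul ht⟩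

/-- The basic open sets form a basis of the Zariski topology. -/
theorem exists_basicOpen_subset {U : Set V} (hU : IsOpen[affineZariski k V] U) {x : V}
    (hx : x ∈ U) : ∃ F : Poly k V, F.value x ≠ 0 ∧ ∀ y, F.value y ≠ 0 → y ∈ U := by
  induction hU with
  | basic s hs =>
    obtain ⟨F, rfl⟩ := hs
    exact ⟨F, hx, fun _ h => h⟩
  | univ => exact ⟨1, by simp [Poly.value], fun _ _ => trivial⟩
  | inter s t _ _ hs ht =>
    obtain ⟨F, hF, hF'⟩ := hs hx.1
    obtain ⟨G, hG, hG'⟩ := ht hx.2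
    refine ⟨F * G, by simp [hF, hG], fun y hy => ?_⟩
    rw [Poly.value_mul] at hy
    exact ⟨hF' y (left_ne_zero_of_mul hy), hG' y (right_ne_zero_of_mul hy)⟩
  | sUnion S _ ih =>
    obtain ⟨s, hs, hxs⟩ := hx
    obtain ⟨F, hF, hF'⟩ := ih s hs hxs
    exact ⟨F, hF, fun y hy => ⟨s, hs, hF' y hy⟩⟩

/-- A property is generic if and only if it holds on a nonempty basic open set. -/
theorem generic_iff_exists_poly [Infinite k] {P : V → Prop} :
    Generic k P ↔ ∃ F : Poly k V, (∃ x, F.value x ≠ 0) ∧ ∀ x, F.value x ≠ 0 → P x := by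
  constructor
  · rintro ⟨U, hU, hd, hP⟩
    let := affineZariski k V
    obtain ⟨x, hx⟩ := hd.nonempty
    obtain ⟨F, hF, hFU⟩ := exists_basicOpen_subset hU hx
    exact ⟨F, ⟨x, hF⟩, fun y hy => hP y (hFU y hy)⟩
  · rintro ⟨F, ⟨x, hx⟩, hP⟩
    refine ⟨{x | F.value x ≠ 0}, TopologicalSpace.isOpen_generateFrom_of_mem ⟨F, rfl⟩, ?_, hP⟩
    let := affineZariski k V
    rw [dense_iff_inter_open]
    rintro W hW ⟨y, hy⟩
    obtain ⟨G, hG, hGW⟩ := exists_basicOpen_subset hW hy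
    obtain ⟨z, hz, hz'⟩ := Poly.exists_value_ne_zero_and hx hG
    exact ⟨z, hGW z hz', hz⟩

theorem Generic.exists [Infinite k] {P : V → Prop} (h : Generic k P) : ∃ x, P x := by
  obtain ⟨F, ⟨x, hx⟩, hP⟩ := generic_iff_exists_poly.1 h
  exact ⟨x, hP x hx⟩

theorem Generic.and [Infinite k] {P Q : V → Prop} (hP : Generic k P) (hQ : Generic k Q) :
    Generic k fun x => P x ∧ Q x := by
  rw [generic_iff_exists_poly] at *
  obtain ⟨F, ⟨x, hx⟩, hF⟩ := hP
  obtain ⟨G, ⟨y, hy⟩, hG⟩ := hQ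
  obtain ⟨z, hz, hz'⟩ := Poly.exists_value_ne_zero_and hx hy
  refine ⟨F * G, ⟨z, by simp [hz, hz']⟩, fun w hw => ?_⟩
  rw [Poly.value_mul] at hw
  exact ⟨hF w (left_ne_zero_of_mul hw), hG w (right_ne_zero_of_mul hw)⟩

/-- A generic property pulls back along a surjective linear map. -/
theorem Generic.comap [Infinite k] {W : Type*} [AddCommGroup W] [Module k W] {P : V → Prop}
    (h : Generic k P) (L : W →ₗ[k] V) (hL : Function.Surjective L) :
    Generic k fun w => P (L w) := by
  rw [generic_iff_exists_poly] at *
  obtain ⟨F, ⟨x, hx⟩, hP⟩ := h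
  have key : ∀ w, Poly.value (MvPolynomial.rename (fun φ : Module.Dual k V => φ.comp L) F) w =
      F.value (L w) := by
    intro w
    simp only [Poly.value, MvPolynomial.eval_rename]
    rfl
  obtain ⟨w, rfl⟩ := hL x
  exact ⟨_, ⟨w, by rwa [key]⟩, fun w hw => hP _ (by rwa [key] at hw)⟩

/-- The span of a finite family contains an independent subfamily of the right size. -/
theorem exists_fin_linearIndependent {B : Type*} [AddCommGroup B] [Module k B] {ι : Type*}
    [Finite ι] (v : ι → B) :
    ∃ e : Fin (Module.finrank k (Submodule.span k (Set.range v))) → ι,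
      LinearIndependent k fun p => v (e p) := by
  obtain ⟨κ, a, ha, hs, hl⟩ := exists_linearIndependent' k v
  have := Finite.of_injective a ha
  have := Fintype.ofFinite κ
  have hc := finrank_span_eq_card hl
  rw [hs] at hc
  exact ⟨fun p => a ((Fintype.equivFinOfCardEq hc.symm).symm p),
    hl.comp _ (Equiv.injective _)⟩

/-- A linearly independent family admits a dual family of functionals. -/
theorem exists_dual_family {B : Type*} [AddCommGroup B] [Module k B] {κ : Type*} [DecidableEq κ]
    {v : κ → B} (hv : LinearIndependent k v) :
    ∃ φ : κ → Module.Dual k B, ∀ p q, φ p (v q) = if p = q then 1 else 0 := by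
  have h : ∀ p, ∃ φ : Module.Dual k B, ∀ q, φ (v q) = if p = q then 1 else 0 := by
    intro p
    obtain ⟨φ, hφ⟩ := LinearMap.exists_extend
      ((Finsupp.lapply p : (κ →₀ k) →ₗ[k] k).comp hv.repr)
    refine ⟨φ, fun q => ?_⟩
    have h1 := LinearMap.congr_fun hφ ⟨v q, Submodule.subset_span (Set.mem_range_self q)⟩
    have h2 := hv.repr_eq_single q ⟨v q, Submodule.subset_span (Set.mem_range_self q)⟩ rfl
    simp only [LinearMap.comp_apply, Submodule.subtype_apply, h2] at h1
    rw [h1]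
    simp [Finsupp.single_apply, eq_comm]
  choose φ hφ using h
  exact ⟨φ, hφ⟩

/-- A map from `V` to a `k`-algebra `B` is polynomial if it is given by a polynomial with
coefficients in `B` in the linear functionals on `V`. -/
def IsPolyMap {B : Type*} [CommRing B] [Algebra k B] (g : V → B) : Prop :=
  ∃ G : MvPolynomial (Module.Dual k V) B, ∀ x,
    g x = MvPolynomial.eval (fun φ : Module.Dual k V => algebraMap k B (φ x)) G

section IsPolyMap

variable {B : Type*} [CommRing B] [Algebra k B]

theorem IsPolyMap.const (b : B) : IsPolyMap (k := k) (fun _ : V => b) :=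
  ⟨MvPolynomial.C b, fun _ => by simp⟩

theorem IsPolyMap.mul {g h : V → B} (hg : IsPolyMap (k := k) g) (hh : IsPolyMap (k := k) h) :
    IsPolyMap (k := k) fun x => g x * h x := by
  obtain ⟨G, hG⟩ := hg
  obtain ⟨H, hH⟩ := hh
  exact ⟨G * H, fun x => by simp only [map_mul, hG, hH]⟩

theorem IsPolyMap.sum {ι : Type*} (s : Finset ι) {g : ι → V → B}
    (hg : ∀ i ∈ s, IsPolyMap (k := k) (g i)) : IsPolyMap (k := k) fun x => ∑ i ∈ s, g i x := by
  choose! G hG using hg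
  refine ⟨∑ i ∈ s, G i, fun x => ?_⟩
  rw [map_sum]
  exact Finset.sum_congr rfl fun i hi => hG i hi x

theorem IsPolyMap.prod {ι : Type*} (s : Finset ι) {g : ι → V → B}
    (hg : ∀ i ∈ s, IsPolyMap (k := k) (g i)) : IsPolyMap (k := k) fun x => ∏ i ∈ s, g i x := by
  choose! G hG using hg
  refine ⟨∏ i ∈ s, G i, fun x => ?_⟩
  rw [map_prod]
  exact Finset.prod_congr rfl fun i hi => hG i hi x

theorem IsPolyMap.dual_smul (φ : Module.Dual k V) (b : B) :
    IsPolyMap (k := k) fun x => φ x • b :=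
  ⟨MvPolynomial.X φ * MvPolynomial.C b, fun x => by simp [Algebra.smul_def]⟩

theorem IsPolyMap.add {g h : V → B} (hg : IsPolyMap (k := k) g) (hh : IsPolyMap (k := k) h) :
    IsPolyMap (k := k) fun x => g x + h x := by
  obtain ⟨G, hG⟩ := hg
  obtain ⟨H, hH⟩ := hh
  exact ⟨G + H, fun x => by simp only [map_add, hG, hH]⟩

/-- A linear map that factors through a finite-dimensional space is polynomial. -/
theorem IsPolyMap.of_linear {W : Type*} [AddCommGroup W] [Module k W] [Module.Finite k W]
    (π : V →ₗ[k] W) (L : W →ₗ[k] B) : IsPolyMap (k := k) fun x => L (π x) := by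
  let b := Module.finBasis k W
  have : (fun x => L (π x)) = fun x => ∑ i, ((b.coord i).comp π) x • L (b i) := by
    funext x
    conv_lhs => rw [← b.sum_repr (π x), map_sum]
    simp only [map_smul, LinearMap.comp_apply, Module.Basis.coord_apply]
  rw [this]
  exact IsPolyMap.sum _ fun i _ => IsPolyMap.dual_smul _ _

/-- Composing a polynomial map with a linear functional yields a polynomial function. -/
theorem IsPolyMap.exists_poly {g : V → B} (hg : IsPolyMap (k := k) g) (φ : Module.Dual k B) :
    ∃ F : Poly k V, ∀ x, F.value x = φ (g x) := by
  obtain ⟨G, hG⟩ := hg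
  simp only [hG]
  clear hG
  induction G using MvPolynomial.induction_on' with
  | monomial m b =>
    refine ⟨MvPolynomial.monomial m (φ b), fun x => ?_⟩
    have : ∀ c : k, b * algebraMap k B c = c • b := fun c => by rw [Algebra.smul_def, mul_comm]
    simp only [Poly.value, MvPolynomial.eval_monomial, Finsupp.prod, ← map_pow, ← map_prod, this,
      map_smul, smul_eq_mul, mul_comm]
  | add p q hp hq =>
    obtain ⟨F, hF⟩ := hp
    obtain ⟨G, hG⟩ := hq
    exact ⟨F + G, fun x => by rw [Poly.value_add, hF, hG, map_add, map_add]⟩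

/-- Lower semicontinuity of the rank of a family of polynomial maps. -/
theorem exists_poly_forall_le_finrank_span [Infinite k] {ι : Type*} [Finite ι] {w : ι → V → B}
    (hw : ∀ i, IsPolyMap (k := k) (w i)) (x₀ : V) :
    ∃ F : Poly k V, F.value x₀ ≠ 0 ∧ ∀ x, F.value x ≠ 0 →
      Module.finrank k (Submodule.span k (Set.range fun i => w i x₀)) ≤
        Module.finrank k (Submodule.span k (Set.range fun i => w i x)) := by
  obtain ⟨e, he⟩ := exists_fin_linearIndependent (k := k) fun i => w i x₀
  -- The matrix of the `φ p (w (e q) x)` is the identity at `x₀`. Its determinant is a polynomial in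
  -- `x`, and wherever it is nonzero the `w (e q) x` remain independent.
  obtain ⟨φ, hφ⟩ := exists_dual_family he
  choose F hF using fun p q => (hw (e q)).exists_poly (φ p)
  have hdet : ∀ x, Poly.value (Matrix.det (Matrix.of F)) x =
      Matrix.det (Matrix.of fun p q => φ p (w (e q) x)) := by
    intro x
    rw [Poly.value, RingHom.map_det]
    congr 1
    ext p q
    exact hF p q x
  refine ⟨Matrix.det (Matrix.of F), ?_, fun x hx => ?_⟩
  · rw [hdet]
    have : (Matrix.of fun p q => φ p (w (e q) x₀)) = 1 := by
      ext p q
      simp [hφ, Matrix.one_apply]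
    rw [this, Matrix.det_one]
    exact one_ne_zero
  · rw [hdet] at hx
    have hl : LinearIndependent k fun q => w (e q) x := by
      rw [Fintype.linearIndependent_iff]
      intro c hc
      have : (Matrix.of fun p q => φ p (w (e q) x)).mulVec c = 0 := by
        funext p
        have := congrArg (φ p) hc
        simpa [Matrix.mulVec, dotProduct, mul_comm] using this
      exact congrFun (Matrix.eq_zero_of_mulVec_eq_zero hx this)
    have hle : Submodule.span k (Set.range fun q => w (e q) x) ≤
        Submodule.span k (Set.range fun i => w i x) :=
      Submodule.span_mono (Set.range_subset_iff.2 fun q => ⟨e q, rfl⟩)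
    have := FiniteDimensional.span_of_finite k (Set.finite_range fun i => w i x)
    simpa [finrank_span_eq_card hl] using Submodule.finrank_mono hle

end IsPolyMap

end PolynomialFunctions

/-! ### The Jacobian criterion -/

section JacobianCriterion

variable {k : Type*} [Field k]

/-- The chain rule for a derivation applied to a polynomial expression. -/
theorem derivation_aeval {A κ : Type*} [CommRing A] [Algebra k A] [Fintype κ]
    (D : Derivation k A A) (G : κ → A) (P : MvPolynomial κ k) :
    D (MvPolynomial.aeval G P) =
      ∑ p, MvPolynomial.aeval G (MvPolynomial.pderiv p P) * D (G p) := by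
  classical
  induction P using MvPolynomial.induction_on with
  | C c => simp
  | add P Q hP hQ => simp only [map_add, hP, hQ, add_mul, Finset.sum_add_distrib]
  | mul_X P i hP =>
    simp only [map_mul, MvPolynomial.aeval_X, Derivation.leibniz, hP, MvPolynomial.pderiv_X,
      smul_eq_mul, map_add, add_mul, Finset.sum_add_distrib, Finset.mul_sum]
    congr 1
    · rw [Finset.sum_eq_single i]
      · simp
      · intro b _ hb
        simp [hb.symm]
      · simp
    · exact Finset.sum_congr rfl fun p _ => by ring

/-- The Jacobian criterion for algebraic independence in characteristic zero. -/
theorem algebraicIndependent_of_det_ne_zero [CharZero k] {A κ : Type*} [CommRing A] [IsDomain A]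
    [Algebra k A] [Fintype κ] [DecidableEq κ] (G : κ → A) (D : κ → Derivation k A A)
    (h : (Matrix.of fun q p => D q (G p)).det ≠ 0) : AlgebraicIndependent k G := by
  rw [algebraicIndependent_iff]
  -- Induction on the degree: by the chain rule and the nonzero determinant, the partial derivatives
  -- of a relation are again relations, of smaller degree. They vanish, so in characteristic zero
  -- the relation is constant.
  suffices H : ∀ (N : ℕ) (P : MvPolynomial κ k), P.totalDegree ≤ N →
      MvPolynomial.aeval G P = 0 → P = 0 from fun P => H _ P le_rfl
  have const : ∀ c : k, MvPolynomial.aeval G (MvPolynomial.C c : MvPolynomial κ k) = 0 → c = 0 := by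
    intro c hc
    rw [MvPolynomial.aeval_C] at hc
    exact (FaithfulSMul.algebraMap_injective k A) (by rw [hc, map_zero])
  intro N
  induction N with
  | zero =>
    intro P hP hG
    rw [MvPolynomial.totalDegree_eq_zero_iff_eq_C.1 (Nat.le_zero.1 hP)] at hG ⊢
    rw [const _ hG, map_zero]
  | succ N ih =>
    intro P hP hG
    have hd : ∀ p, MvPolynomial.aeval G (MvPolynomial.pderiv p P) = 0 := by
      refine congrFun (Matrix.eq_zero_of_mulVec_eq_zero h
        (v := fun p => MvPolynomial.aeval G (MvPolynomial.pderiv p P)) ?_)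
      funext q
      have := derivation_aeval (D q) G P
      rw [hG, map_zero] at this
      simp only [Matrix.mulVec, dotProduct, Matrix.of_apply, Pi.zero_apply]
      rw [this]
      exact Finset.sum_congr rfl fun p _ => mul_comm _ _
    have hz : ∀ p, MvPolynomial.pderiv p P = 0 := by
      refine fun p => ih _ ?_ (hd p)
      refine Finset.sup_le fun m hm => ?_
      rw [MvPolynomial.mem_support_iff, MvPolynomial.coeff_pderiv] at hm
      have := (MvPolynomial.le_totalDegree
        (MvPolynomial.mem_support_iff.2 (left_ne_zero_of_mul hm))).trans hP
      rw [Finsupp.sum_add_index' (fun _ => rfl) (fun _ _ _ => rfl),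
        Finsupp.sum_single_index rfl] at this
      exact Nat.le_of_succ_le_succ this
    have hC : P = MvPolynomial.C (P.coeff 0) := by
      ext m
      rw [MvPolynomial.coeff_C]
      split_ifs with hm
      · rw [hm]
      · obtain ⟨i, hi⟩ : ∃ i, m i ≠ 0 := by
          by_contra! hall
          exact hm (Finsupp.ext fun i => by simp [hall i])
        have h1 := congrArg (MvPolynomial.coeff (m - Finsupp.single i 1)) (hz i)
        rw [MvPolynomial.coeff_pderiv, tsub_add_cancel_of_le
          (Finsupp.single_le_iff.2 (Nat.one_le_iff_ne_zero.2 hi)), MvPolynomial.coeff_zero] at h1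
        refine (mul_eq_zero.1 h1).resolve_right ?_
        exact Nat.cast_add_one_ne_zero _
    rw [hC] at hG ⊢
    rw [const _ hG, map_zero]

/-- The directional derivative of a polynomial is the linear coefficient of its restriction to
a line. -/
theorem coeff_one_aeval_line {ι : Type*} (G : MvPolynomial ι k) (z w : ι → k) :
    (MvPolynomial.aeval (fun i => Polynomial.C (z i) + Polynomial.C (w i) * Polynomial.X) G).coeff 1
      = MvPolynomial.eval z (MvPolynomial.mkDerivation k (fun i => MvPolynomial.C (w i)) G) := by
  have h0 : ∀ G : MvPolynomial ι k, (MvPolynomial.aeval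
      (fun i => Polynomial.C (z i) + Polynomial.C (w i) * Polynomial.X) G).coeff 0 =
      MvPolynomial.eval z G := by
    intro G
    induction G using MvPolynomial.induction_on with
    | C c => simp
    | add P Q hP hQ => simp [hP, hQ]
    | mul_X P i hP => simp [Polynomial.mul_coeff_zero, hP]
  induction G using MvPolynomial.induction_on with
  | C c => simp
  | add P Q hP hQ => simp [hP, hQ]
  | mul_X P i hP =>
    simp only [map_mul, MvPolynomial.aeval_X, Derivation.leibniz, MvPolynomial.mkDerivation_X,
      smul_eq_mul, map_add, MvPolynomial.eval_X, MvPolynomial.eval_C, Polynomial.mul_coeff_one, h0,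
      hP]
    simp [Polynomial.coeff_C]
    ring

end JacobianCriterion

/-! ### Dimension of closures of images of polynomial maps -/

section AffineDim

variable {k : Type*} [Field k] {V : Type*} [AddCommGroup V] [Module k V]

theorem mem_vanishingIdeal {Z : Set V} {F : Poly k V} :
    F ∈ vanishingIdeal k Z ↔ ∀ x ∈ Z, F.value x = 0 := Iff.rfl

theorem vanishingIdeal_ne_top {Z : Set V} (hZ : Z.Nonempty) : vanishingIdeal k Z ≠ ⊤ := by
  obtain ⟨x, hx⟩ := hZ
  rw [Ideal.ne_top_iff_one, mem_vanishingIdeal]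
  intro h
  exact one_ne_zero ((map_one (MvPolynomial.eval fun φ : Module.Dual k V => φ x)).symm.trans
    (h x hx))

/-- `Poly k V` has one variable for every functional, but as functions all of them are combinations
of the finitely many coordinates of a basis, so these generate the quotient. -/
instance finiteType_coordinateRing [Module.Finite k V] (Z : Set V) :
    Algebra.FiniteType k (CoordinateRing k Z) := by
  let b := Module.finBasis k V
  let f : MvPolynomial (Fin (Module.finrank k V)) k →ₐ[k] CoordinateRing k Z :=
    MvPolynomial.aeval fun i => Ideal.Quotient.mkₐ k (vanishingIdeal k Z)
      (MvPolynomial.X (b.coord i))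
  refine Algebra.FiniteType.of_surjective f ?_
  intro q
  obtain ⟨p, rfl⟩ := Ideal.Quotient.mkₐ_surjective k (vanishingIdeal k Z) q
  induction p using MvPolynomial.induction_on with
  | C c => exact ⟨MvPolynomial.C c, by simp [f]⟩
  | add p q hp hq =>
    obtain ⟨a, ha⟩ := hp
    obtain ⟨c, hc⟩ := hq
    exact ⟨a + c, by rw [map_add, map_add, ha, hc]⟩
  | mul_X p φ hp =>
    obtain ⟨a, ha⟩ := hp
    refine ⟨a * ∑ i, MvPolynomial.C (φ (b i)) * MvPolynomial.X i, ?_⟩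
    rw [map_mul, map_mul, ha]
    congr 1
    have : f (∑ i, MvPolynomial.C (φ (b i)) * MvPolynomial.X i) =
        Ideal.Quotient.mkₐ k (vanishingIdeal k Z)
          (∑ i, MvPolynomial.C (φ (b i)) * MvPolynomial.X (b.coord i)) := by
      simp only [f, map_sum, map_mul, MvPolynomial.aeval_X, MvPolynomial.aeval_C]
      rfl
    rw [this]
    refine (Ideal.Quotient.eq).2 ?_
    rw [mem_vanishingIdeal]
    intro x _
    simp only [Poly.value, map_sub, map_sum, map_mul, MvPolynomial.eval_X, MvPolynomial.eval_C]
    rw [sub_eq_zero]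
    conv_rhs => rw [← b.sum_repr x, map_sum]
    exact Finset.sum_congr rfl fun i _ => by
      rw [map_smul, smul_eq_mul, mul_comm, Module.Basis.coord_apply]

/-- By Noether normalization the Krull dimension is a natural number, so the default values in
`affineDim` do not intervene. -/
theorem coe_affineDim [Module.Finite k V] {Z : Set V} (hZ : vanishingIdeal k Z ≠ ⊤) :
    (affineDim k Z : WithBot ℕ∞) = ringKrullDim (CoordinateRing k Z) := by
  have : Nontrivial (CoordinateRing k Z) := Ideal.Quotient.nontrivial_iff.2 hZ
  obtain ⟨r, -, -, -, hr⟩ := exists_noether_normalization_ringKrullDim (k := k)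
    (C := CoordinateRing k Z)
  rw [affineDim, hr]
  rfl

/-- The larger ideal gives a quotient of the other coordinate ring. Comparing ideals rather than
sets also covers a `Z` that lies only in the Zariski closure of `Z'`. -/
theorem affineDim_mono [Module.Finite k V] {Z Z' : Set V} (hZ : Z.Nonempty)
    (h : vanishingIdeal k Z' ≤ vanishingIdeal k Z) : affineDim k Z ≤ affineDim k Z' := by
  have hZ0 := vanishingIdeal_ne_top (k := k) hZ
  have := ringKrullDim_le_of_surjective (Ideal.Quotient.factor h)
    (Ideal.Quotient.factor_surjective h)
  rw [← coe_affineDim hZ0, ← coe_affineDim (ne_top_of_le_ne_top hZ0 h)] at this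
  exact_mod_cast this

variable {ι : Type*}

/-- A polynomial function on a coordinate space is given by a polynomial in the coordinates. -/
theorem Poly.exists_eval_eq [Fintype ι] (F : Poly k (ι → k)) :
    ∃ G : MvPolynomial ι k, ∀ x, MvPolynomial.eval x G = F.value x := by
  classical
  refine ⟨MvPolynomial.aeval (fun φ : Module.Dual k (ι → k) =>
    ∑ i, MvPolynomial.C (φ (Pi.single i 1)) * MvPolynomial.X i) F, fun x => ?_⟩
  rw [MvPolynomial.aeval_def, MvPolynomial.hom_eval₂, Poly.value]
  change _ = MvPolynomial.eval₂ _ _ F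
  congr 1
  · ext; simp
  · funext φ
    conv_rhs => rw [← Finset.univ_sum_single x, map_sum]
    simp only [map_sum]
    refine Finset.sum_congr rfl fun i _ => ?_
    have : (Pi.single i (x i) : ι → k) = x i • Pi.single i 1 := by
      rw [← Pi.single_smul, smul_eq_mul, mul_one]
    rw [this, map_smul]
    simp [mul_comm]

/-- The pullback of regular functions along a polynomial parametrization. -/
theorem exists_coordinateRing_embedding [Infinite k] {g : (ι → k) → V}
    (hg : ∀ φ : Module.Dual k V, ∃ G : MvPolynomial ι k, ∀ x, MvPolynomial.eval x G = φ (g x)) :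
    ∃ h : CoordinateRing k (Set.range g) →ₐ[k] MvPolynomial ι k, Function.Injective h ∧
      ∀ (φ : Module.Dual k V) (x : ι → k), MvPolynomial.eval x
        (h (Ideal.Quotient.mk _ (MvPolynomial.X φ))) = φ (g x) := by
  choose G hG using hg
  have key : ∀ (F : Poly k V) x, MvPolynomial.eval x (MvPolynomial.aeval G F) = F.value (g x) := by
    intro F x
    rw [MvPolynomial.aeval_def, MvPolynomial.hom_eval₂]
    unfold Poly.value MvPolynomial.eval
    simp only [MvPolynomial.coe_eval₂Hom]
    congr 1
    · ext; simp
    · funext φ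
      exact hG φ x
  have ker : ∀ F : Poly k V, MvPolynomial.aeval G F = 0 ↔ F ∈ vanishingIdeal k (Set.range g) := by
    intro F
    rw [mem_vanishingIdeal]
    constructor
    · rintro h _ ⟨x, rfl⟩
      rw [← key, h, map_zero]
    · intro h
      refine MvPolynomial.funext fun x => ?_
      rw [key, h _ ⟨x, rfl⟩, map_zero]
  refine ⟨Ideal.Quotient.liftₐ _ (MvPolynomial.aeval G) fun F hF => (ker F).2 hF, ?_, ?_⟩
  · rw [injective_iff_map_eq_zero]
    intro q hq
    obtain ⟨p, rfl⟩ := Ideal.Quotient.mk_surjective q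
    exact Ideal.Quotient.eq_zero_iff_mem.2 ((ker p).1 hq)
  · intro φ x
    rw [← hG φ x]
    congr 1
    exact MvPolynomial.aeval_X G φ

/-- The closure of the image of a polynomial map has dimension at most that of its source. -/
theorem affineDim_range_le [Infinite k] [Module.Finite k V] [Fintype ι] {g : (ι → k) → V}
    (hg : ∀ φ : Module.Dual k V, ∃ G : MvPolynomial ι k, ∀ x, MvPolynomial.eval x G = φ (g x)) :
    affineDim k (Set.range g) ≤ Fintype.card ι := by
  obtain ⟨h, hh, -⟩ := exists_coordinateRing_embedding hg
  have h0 := vanishingIdeal_ne_top (k := k) (Set.range_nonempty g)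
  have : Nontrivial (CoordinateRing k (Set.range g)) := Ideal.Quotient.nontrivial_iff.2 h0
  have := ringKrullDim_le_card_of_injective h hh
  rw [← coe_affineDim h0] at this
  exact_mod_cast this

/-- In characteristic zero, the closure of the image of a polynomial map has dimension at least the
rank of its differential at any point. -/
theorem le_affineDim_range [CharZero k] [Module.Finite k V] [Finite ι] {g : (ι → k) → V}
    (hg : ∀ φ : Module.Dual k V, ∃ G : MvPolynomial ι k, ∀ x, MvPolynomial.eval x G = φ (g x))
    {a : ℕ} (z : ι → k) (w : Fin a → ι → k) (T : Fin a → V) (hT : LinearIndependent k T)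
    (hw : ∀ q (φ : Module.Dual k V), ∃ r : Polynomial k,
      (∀ t, r.eval t = φ (g (z + t • w q))) ∧ r.coeff 1 = φ (T q)) :
    a ≤ affineDim k (Set.range g) := by
  obtain ⟨h, hh, hφ⟩ := exists_coordinateRing_embedding hg
  have h0 := vanishingIdeal_ne_top (k := k) (Set.range_nonempty g)
  have : IsDomain (CoordinateRing k (Set.range g)) := hh.isDomain h.toRingHom
  obtain ⟨φ, hφT⟩ := exists_dual_family hT
  let y : Fin a → CoordinateRing k (Set.range g) :=
    fun p => Ideal.Quotient.mk _ (MvPolynomial.X (φ p))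
  -- At `z` the Jacobian matrix of the pulled-back functions `φ p` in the directions `w q` is the
  -- identity, by duality with the tangent vectors `T q`.
  have hd : ∀ q p, MvPolynomial.eval z (MvPolynomial.mkDerivation k
      (fun i => MvPolynomial.C (w q i)) (h (y p))) = φ p (T q) := by
    intro q p
    obtain ⟨r, hr, hr1⟩ := hw q (φ p)
    rw [← coeff_one_aeval_line, ← hr1]
    congr 1
    refine Polynomial.funext fun t => ?_
    rw [hr, ← hφ (φ p), ← Polynomial.coe_evalRingHom, MvPolynomial.aeval_def,
      MvPolynomial.hom_eval₂]
    unfold MvPolynomial.eval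
    simp only [MvPolynomial.coe_eval₂Hom]
    congr 1
    · ext; simp
    · funext i
      simpa using mul_comm _ _
  have hy : AlgebraicIndependent k y := by
    refine AlgebraicIndependent.of_comp h ?_
    refine algebraicIndependent_of_det_ne_zero _
      (fun q => MvPolynomial.mkDerivation k (fun i => MvPolynomial.C (w q i))) fun h' => ?_
    have h1 := congrArg (MvPolynomial.eval z) h'
    rw [RingHom.map_det, map_zero] at h1
    refine one_ne_zero (α := k) (Eq.trans ?_ h1)
    rw [← Matrix.det_one (n := Fin a)]
    congr 1
    ext q p
    refine Eq.trans ?_ ((hd q p).trans (hφT p q)).symm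
    simp only [Matrix.one_apply, eq_comm]
  have := le_ringKrullDim_of_algebraicIndependent hy
  rw [← coe_affineDim h0] at this
  exact_mod_cast this

/-- A version of `le_affineDim_range` for maps from an arbitrary vector space. -/
theorem le_affineDim_range_of_finite [CharZero k] [Module.Finite k V] {W : Type*} [AddCommGroup W]
    [Module k W] [Module.Finite k W] {g : W → V}
    (hg : ∀ φ : Module.Dual k V, ∃ G : Poly k W, ∀ x, G.value x = φ (g x))
    {a : ℕ} (z : W) (w : Fin a → W) (T : Fin a → V) (hT : LinearIndependent k T)
    (hw : ∀ q (φ : Module.Dual k V), ∃ r : Polynomial k,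
      (∀ t, r.eval t = φ (g (z + t • w q))) ∧ r.coeff 1 = φ (T q)) :
    a ≤ affineDim k (Set.range g) := by
  let b := (Module.finBasis k W).equivFun
  have hr : Set.range (fun x => g (b.symm x)) = Set.range g := b.symm.surjective.range_comp g
  rw [← hr]
  refine le_affineDim_range (fun φ => ?_) (b z) (fun q => b (w q)) T hT fun q φ => ?_
  · obtain ⟨G, hG⟩ := hg φ
    obtain ⟨H, hH⟩ := Poly.exists_comp (g := b.symm)
      (fun ψ => ⟨MvPolynomial.X (ψ.comp b.symm.toLinearMap), fun x => Poly.value_X _ _⟩) G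
    obtain ⟨P, hP⟩ := H.exists_eval_eq
    exact ⟨P, fun x => by rw [hP, hH, hG]⟩
  · obtain ⟨r, hr, hr1⟩ := hw q φ
    exact ⟨r, fun t => by rw [hr, map_add, map_smul, b.symm_apply_apply, b.symm_apply_apply], hr1⟩

end AffineDim

/-! ### Upper bound for the spaces of forms, and reduction to a single good choice -/

section Forms

variable {k : Type*} [Field k]

instance finite_form (n d : ℕ) : Module.Finite k (Form k n d) :=
  Module.Finite.iff_fg.2 (MvPolynomial.homogeneousSubmodule_fg _ _ d)

theorem finrank_form_one_le (n : ℕ) : Module.finrank k (Form k n 1) ≤ n + 1 := by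
  unfold Form
  rw [MvPolynomial.homogeneousSubmodule_one_eq_span_X]
  exact (finrank_range_le_card (R := k)
    (MvPolynomial.X : Fin (n + 1) → MvPolynomial _ k)).trans (by simp)

theorem finrank_iSup_le {M : Type*} [AddCommGroup M] [Module k M] {r c : ℕ}
    (W : Fin r → Submodule k M) [∀ i, Module.Finite k (W i)]
    (hW : ∀ i, Module.finrank k (W i) ≤ c) : Module.finrank k (⨆ i, W i : Submodule k M) ≤ r * c := by
  induction r with
  | zero => simp
  | succ r ih =>
    have h : (⨆ i, W i) = W 0 ⊔ ⨆ i : Fin r, W i.succ := by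
      apply le_antisymm
      · refine iSup_le fun i => ?_
        refine Fin.cases le_sup_left (fun i => ?_) i
        exact le_sup_of_le_right (le_iSup (fun i : Fin r => W i.succ) i)
      · exact sup_le (le_iSup W 0) (iSup_le fun i => le_iSup W i.succ)
    rw [h]
    have h1 := ih (fun i => W i.succ) fun i => hW i.succ
    have h2 := Submodule.finrank_add_le_finrank_add_finrank (W 0) (⨆ i : Fin r, W i.succ)
    have h3 := hW 0
    have h4 : (r + 1) * c = r * c + c := by ring
    omega

theorem mem_mulLinear {n : ℕ} {g p : MvPolynomial (Fin (n + 1)) k} :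
    p ∈ mulLinear g ↔ ∃ l : Form k n 1, g * l.1 = p := by
  simp [mulLinear, Submodule.mem_map]

instance finite_mulLinear {n : ℕ} (g : MvPolynomial (Fin (n + 1)) k) :
    Module.Finite k (mulLinear g) := by
  unfold mulLinear
  infer_instance

theorem mulLinear_eq_span {n : ℕ} (g : MvPolynomial (Fin (n + 1)) k) :
    mulLinear g = Submodule.span k (Set.range fun i => g * MvPolynomial.X i) := by
  unfold mulLinear Form
  rw [MvPolynomial.homogeneousSubmodule_one_eq_span_X, Submodule.map_span, ← Set.range_comp]
  rfl

theorem finrank_mulLinear_le {n : ℕ} (g : MvPolynomial (Fin (n + 1)) k) :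
    Module.finrank k (mulLinear g) ≤ n + 1 :=
  (Submodule.finrank_map_le _ _).trans (finrank_form_one_le n)

theorem omitProd_mul {n r : ℕ} (f : Fin r → Form k n 1) (m : Fin r) :
    omitProd m f * (f m).1 = ∏ i, (f i).1 := by
  rw [omitProd, mul_comm]
  have : Finset.univ.filter (fun i : Fin r => (i : ℕ) ≠ m) = Finset.univ.erase m := by
    ext i
    simp [Fin.ext_iff]
  rw [this, Finset.mul_prod_erase _ (fun i => (f i).1) (Finset.mem_univ m)]

theorem omitProd_eq_zero {n r : ℕ} {f : Fin r → Form k n 1} {i m : Fin r} (hi : f i = 0)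
    (him : i ≠ m) : omitProd m f = 0 :=
  Finset.prod_eq_zero (i := i) (by simpa [Fin.ext_iff] using him) (by simp [hi])

theorem omitProd_zero {n r : ℕ} (f : Fin (r + 1) → Form k n 1) :
    omitProd 0 f = ∏ i : Fin r, (f i.succ).1 := by
  rw [omitProd, Finset.prod_filter, Fin.prod_univ_succ]
  simp

theorem omitProd_succ {n r : ℕ} (f : Fin (r + 1) → Form k n 1) (m : ℕ) :
    omitProd (m + 1) f = (f 0).1 * omitProd m (Fin.tail f) := by
  rw [omitProd, Finset.prod_filter, Fin.prod_univ_succ, omitProd, Finset.prod_filter]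
  simp [Fin.tail]

/-- The tangent space to the cone of products of `d` linear forms has dimension at most `dn+1`. -/
theorem finrank_iSup_mulLinear_omitProd_le {n d : ℕ} (hd : 1 ≤ d) (f : Fin d → Form k n 1) :
    Module.finrank k (⨆ m : Fin d, mulLinear (omitProd m f) :
      Submodule k (MvPolynomial (Fin (n + 1)) k)) ≤ d * n + 1 := by
  -- If an entry vanishes, only the summand omitting it can be nonzero, and `n + 1 ≤ d * n + 1`
  -- because `d ≥ 1`.
  by_cases hf : ∃ i, f i = 0
  · obtain ⟨i, hi⟩ := hf
    have hle : (⨆ m : Fin d, mulLinear (omitProd m f)) ≤ mulLinear (omitProd i f) := by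
      refine iSup_le fun m => ?_
      by_cases him : i = m
      · rw [him]
      · rw [omitProd_eq_zero hi him]
        rintro p hp
        obtain ⟨l, rfl⟩ := mem_mulLinear.1 hp
        simp
    refine (Submodule.finrank_mono hle).trans ((finrank_mulLinear_le _).trans ?_)
    exact Nat.succ_le_succ (Nat.le_mul_of_pos_left n hd)
  · push Not at hf
    -- All summands share the full product. Splitting `R_1` as the line of `f m` plus a complement
    -- of dimension at most `n` gives the count `1 + d * n`.
    choose H hH using fun m => Submodule.exists_isCompl (Submodule.span k {f m})
    have hHn : ∀ m, Module.finrank k (H m) ≤ n := by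
      intro m
      have h1 := Submodule.finrank_add_eq_of_isCompl (hH m)
      rw [finrank_span_singleton (hf m)] at h1
      have := finrank_form_one_le (k := k) n
      omega
    let W : Fin d → Submodule k (MvPolynomial (Fin (n + 1)) k) := fun m =>
      (H m).map ((LinearMap.mulLeft k (omitProd m f)).comp (Form k n 1).subtype)
    have hle : (⨆ m : Fin d, mulLinear (omitProd m f)) ≤
        Submodule.span k {∏ i, (f i).1} ⊔ ⨆ m, W m := by
      refine iSup_le fun m p hp => ?_
      obtain ⟨l, rfl⟩ := mem_mulLinear.1 hp
      obtain ⟨a, ha, b, hb, rfl⟩ := Submodule.mem_sup.1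
        ((hH m).sup_eq_top ▸ Submodule.mem_top : l ∈ Submodule.span k {f m} ⊔ H m)
      obtain ⟨c, rfl⟩ := Submodule.mem_span_singleton.1 ha
      rw [Submodule.coe_add, mul_add]
      refine Submodule.add_mem_sup ?_ ?_
      · rw [Submodule.coe_smul, mul_smul_comm, omitProd_mul]
        exact Submodule.smul_mem _ _ (Submodule.mem_span_singleton_self _)
      · exact Submodule.mem_iSup_of_mem m ⟨b, hb, rfl⟩
    have h1 := Submodule.finrank_mono hle
    have h2 := Submodule.finrank_add_le_finrank_add_finrank (Submodule.span k {∏ i, (f i).1})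
      (⨆ m, W m)
    have h3 := finrank_iSup_le W fun m => (Submodule.finrank_map_le _ _).trans (hHn m)
    have h4 := finrank_span_le_card (R := k) ({∏ i, (f i).1} : Set (MvPolynomial (Fin (n + 1)) k))
    simp only [Set.toFinset_singleton, Finset.card_singleton] at h4
    omega

theorem finrank_span_singleton_le_one {M : Type*} [AddCommGroup M] [Module k M] (x : M) :
    Module.finrank k (Submodule.span k {x}) ≤ 1 := by
  simpa using finrank_span_le_card (R := k) ({x} : Set M)

variable {n d s t u v : ℕ}

/-- The dimension of the space is always at most the expected one. -/
theorem finrank_spaceA_le (hd : 1 ≤ d) (f : Tuples k n d s t u v) :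
    Module.finrank k (spaceA f) ≤ expA n d s t u v := by
  have h1 := finrank_iSup_le _ fun j => finrank_iSup_mulLinear_omitProd_le hd (f.1 j)
  have h2 := finrank_iSup_le (fun j : Fin t => Submodule.span k {omitProd 0 (f.2.1 j)})
    fun j => finrank_span_singleton_le_one _
  have h3 := finrank_iSup_le
    (fun j : Fin u => ⨆ m : Fin (d + 1), Submodule.span k {omitProd m (f.2.2.1 j)})
    fun j => finrank_iSup_le _ fun m => finrank_span_singleton_le_one _
  have h4 := finrank_iSup_le (fun j : Fin v => mulLinear (omitProd 0 (f.2.2.2 j)))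
    fun j => finrank_mulLinear_le _
  have e1 := Submodule.finrank_add_le_finrank_add_finrank
    (⨆ j : Fin s, ⨆ m : Fin d, mulLinear (omitProd m (f.1 j)))
    (⨆ j : Fin t, Submodule.span k {omitProd 0 (f.2.1 j)})
  have e2 := Submodule.finrank_add_le_finrank_add_finrank
    ((⨆ j : Fin s, ⨆ m : Fin d, mulLinear (omitProd m (f.1 j))) ⊔
      (⨆ j : Fin t, Submodule.span k {omitProd 0 (f.2.1 j)}))
    (⨆ j : Fin u, ⨆ m : Fin (d + 1), Submodule.span k {omitProd m (f.2.2.1 j)})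
  have e3 := Submodule.finrank_add_le_finrank_add_finrank
    ((⨆ j : Fin s, ⨆ m : Fin d, mulLinear (omitProd m (f.1 j))) ⊔
      (⨆ j : Fin t, Submodule.span k {omitProd 0 (f.2.1 j)}) ⊔
      (⨆ j : Fin u, ⨆ m : Fin (d + 1), Submodule.span k {omitProd m (f.2.2.1 j)}))
    (⨆ j : Fin v, mulLinear (omitProd 0 (f.2.2.2 j)))
  have c : expA n d s t u v = s * (d * n + 1) + t * 1 + u * ((d + 1) * 1) + v * (n + 1) := by
    unfold expA
    ring
  unfold spaceA
  omega

theorem mul_mem_spaceA_left (f : Tuples k n d s t u v) (j : Fin s) (m : Fin d) (l : Form k n 1) :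
    omitProd m (f.1 j) * l.1 ∈ spaceA f :=
  Submodule.mem_sup_left (Submodule.mem_sup_left (Submodule.mem_sup_left
    (Submodule.mem_iSup_of_mem j (Submodule.mem_iSup_of_mem m (mem_mulLinear.2 ⟨l, rfl⟩)))))

theorem omitProd_zero_mem_spaceA (f : Tuples k n d s t u v) (j : Fin t) :
    omitProd 0 (f.2.1 j) ∈ spaceA f :=
  Submodule.mem_sup_left (Submodule.mem_sup_left (Submodule.mem_sup_right
    (Submodule.mem_iSup_of_mem j (Submodule.mem_span_singleton_self _))))

theorem omitProd_mem_spaceA (f : Tuples k n d s t u v) (j : Fin u) (m : Fin (d + 1)) :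
    omitProd m (f.2.2.1 j) ∈ spaceA f :=
  Submodule.mem_sup_left (Submodule.mem_sup_right (Submodule.mem_iSup_of_mem j
    (Submodule.mem_iSup_of_mem m (Submodule.mem_span_singleton_self _))))

theorem mul_mem_spaceA_right (f : Tuples k n d s t u v) (j : Fin v) (l : Form k n 1) :
    omitProd 0 (f.2.2.2 j) * l.1 ∈ spaceA f :=
  Submodule.mem_sup_right (Submodule.mem_iSup_of_mem j (mem_mulLinear.2 ⟨l, rfl⟩))

theorem spaceA_le {f : Tuples k n d s t u v} {M : Submodule k (MvPolynomial (Fin (n + 1)) k)}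
    (hs : ∀ (j : Fin s) (m : Fin d) (l : Form k n 1), omitProd m (f.1 j) * l.1 ∈ M)
    (ht : ∀ j : Fin t, omitProd 0 (f.2.1 j) ∈ M)
    (hu : ∀ (j : Fin u) (m : Fin (d + 1)), omitProd m (f.2.2.1 j) ∈ M)
    (hv : ∀ (j : Fin v) (l : Form k n 1), omitProd 0 (f.2.2.2 j) * l.1 ∈ M) : spaceA f ≤ M := by
  refine sup_le (sup_le (sup_le ?_ ?_) ?_) ?_
  · refine iSup_le fun j => iSup_le fun m p hp => ?_
    obtain ⟨l, rfl⟩ := mem_mulLinear.1 hp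
    exact hs j m l
  · exact iSup_le fun j => (Submodule.span_singleton_le_iff_mem _ _).2 (ht j)
  · exact iSup_le fun j => iSup_le fun m => (Submodule.span_singleton_le_iff_mem _ _).2 (hu j m)
  · refine iSup_le fun j p hp => ?_
    obtain ⟨l, rfl⟩ := mem_mulLinear.1 hp
    exact hv j l

/-- The index type of the standard spanning family of the space. -/
abbrev GenIndex (n d s t u v : ℕ) : Type :=
  (Fin s × Fin d × Fin (n + 1)) ⊕ Fin t ⊕ (Fin u × Fin (d + 1)) ⊕ (Fin v × Fin (n + 1))

/-- The standard spanning family of the space. -/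
def spaceGen : GenIndex n d s t u v → Tuples k n d s t u v → MvPolynomial (Fin (n + 1)) k
  | .inl (j, m, i), f => omitProd m (f.1 j) * MvPolynomial.X i
  | .inr (.inl j), f => omitProd 0 (f.2.1 j)
  | .inr (.inr (.inl (j, m))), f => omitProd m (f.2.2.1 j)
  | .inr (.inr (.inr (j, i))), f => omitProd 0 (f.2.2.2 j) * MvPolynomial.X i

theorem span_spaceGen (f : Tuples k n d s t u v) :
    Submodule.span k (Set.range fun i => spaceGen i f) = spaceA f := by
  have hX : ∀ i : Fin (n + 1), MvPolynomial.X i ∈ Form k n 1 := MvPolynomial.isHomogeneous_X k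
  have mem : ∀ i, spaceGen i f ∈ Submodule.span k (Set.range fun i => spaceGen i f) :=
    fun i => Submodule.subset_span ⟨i, rfl⟩
  have lin : ∀ (g : MvPolynomial (Fin (n + 1)) k) (M : Submodule k (MvPolynomial (Fin (n + 1)) k)),
      (∀ i, g * MvPolynomial.X i ∈ M) → ∀ l : Form k n 1, g * l.1 ∈ M := by
    intro g M h l
    have h1 : mulLinear g ≤ M := by
      rw [mulLinear_eq_span, Submodule.span_le]
      rintro _ ⟨i, rfl⟩
      exact h i
    exact h1 (mem_mulLinear.2 ⟨l, rfl⟩)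
  apply le_antisymm
  · rw [Submodule.span_le]
    rintro _ ⟨⟨j, m, i⟩ | j | ⟨j, m⟩ | ⟨j, i⟩, rfl⟩
    · exact mul_mem_spaceA_left f j m ⟨_, hX i⟩
    · exact omitProd_zero_mem_spaceA f j
    · exact omitProd_mem_spaceA f j m
    · exact mul_mem_spaceA_right f j ⟨_, hX i⟩
  · refine spaceA_le (fun j m => ?_) (fun j => mem (.inr (.inl j)))
      (fun j m => mem (.inr (.inr (.inl (j, m))))) (fun j => ?_)
    · exact lin _ _ fun i => mem (.inl (j, m, i))
    · exact lin _ _ fun i => mem (.inr (.inr (.inr (j, i))))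

instance finite_spaceA (f : Tuples k n d s t u v) : Module.Finite k (spaceA f) := by
  rw [← span_spaceGen]
  exact FiniteDimensional.span_of_finite k (Set.finite_range _)

theorem isPolyMap_omitProd {V : Type*} [AddCommGroup V] [Module k V] {r : ℕ} (m : ℕ)
    (L : V →ₗ[k] (Fin r → Form k n 1)) : IsPolyMap (k := k) fun x => omitProd m (L x) :=
  IsPolyMap.prod _ fun i _ =>
    IsPolyMap.of_linear ((LinearMap.proj i).comp L) (Form k n 1).subtype

theorem isPolyMap_spaceGen (i : GenIndex n d s t u v) :
    IsPolyMap (k := k) (spaceGen (k := k) i) := by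
  obtain ⟨j, m, i⟩ | j | ⟨j, m⟩ | ⟨j, i⟩ := i
  · let L : Tuples k n d s t u v →ₗ[k] (Fin d → Form k n 1) :=
      ⟨⟨fun f => f.1 j, fun _ _ => rfl⟩, fun _ _ => rfl⟩
    exact (isPolyMap_omitProd (m : ℕ) L).mul (.const _)
  · let L : Tuples k n d s t u v →ₗ[k] (Fin (d + 1) → Form k n 1) :=
      ⟨⟨fun f => f.2.1 j, fun _ _ => rfl⟩, fun _ _ => rfl⟩
    exact isPolyMap_omitProd 0 L
  · let L : Tuples k n d s t u v →ₗ[k] (Fin (d + 1) → Form k n 1) :=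
      ⟨⟨fun f => f.2.2.1 j, fun _ _ => rfl⟩, fun _ _ => rfl⟩
    exact isPolyMap_omitProd (m : ℕ) L
  · let L : Tuples k n d s t u v →ₗ[k] (Fin d → Form k n 1) :=
      ⟨⟨fun f => f.2.2.2 j, fun _ _ => rfl⟩, fun _ _ => rfl⟩
    exact (isPolyMap_omitProd 0 L).mul (.const _)

/-- In the subabundant case, one good choice of the linear forms suffices. -/
theorem isTrue_of_exists [Infinite k] (hd : 1 ≤ d) (hsub : IsSubabundant n d s t u v)
    (f₀ : Tuples k n d s t u v) (h : expA n d s t u v ≤ Module.finrank k (spaceA f₀)) :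
    IsTrue k n d s t u v := by
  obtain ⟨F, hF, hF'⟩ := exists_poly_forall_le_finrank_span (k := k)
    (isPolyMap_spaceGen (k := k) (n := n) (d := d) (s := s) (t := t) (u := u) (v := v)) f₀
  refine generic_iff_exists_poly.2 ⟨F, ⟨f₀, hF⟩, fun f hf => ?_⟩
  have := hF' f hf
  rw [span_spaceGen, span_spaceGen] at this
  -- The upper bound holds for every choice of forms and semicontinuity gives the lower one.
  rw [min_eq_left hsub]
  exact le_antisymm (finrank_spaceA_le hd f) (h.trans this)

end Forms

/-! ### Specialization to `x_0` and splitting into layers -/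

section Splitting

variable {k : Type*} [Field k] {n : ℕ}

/-- The inclusion of the polynomial ring in the variables `x_1, …, x_{n+1}`. -/
abbrev embed (k : Type*) [Field k] (n : ℕ) :
    MvPolynomial (Fin (n + 1)) k →ₐ[k] MvPolynomial (Fin (n + 1 + 1)) k :=
  MvPolynomial.rename Fin.succ

/-- The inclusion on linear forms. -/
def embedForm (l : Form k n 1) : Form k (n + 1) 1 :=
  ⟨embed k n l.1, (MvPolynomial.mem_homogeneousSubmodule _ _).2
    (MvPolynomial.IsHomogeneous.rename_isHomogeneous l.2)⟩

/-- The inclusion on tuples of linear forms. -/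
def embedTuple {r : ℕ} (g : Fin r → Form k n 1) : Fin r → Form k (n + 1) 1 :=
  fun i => embedForm (g i)

/-- The variable `x_0`, as a linear form. -/
def formX (k : Type*) [Field k] (n : ℕ) : Form k (n + 1) 1 :=
  ⟨MvPolynomial.X 0, MvPolynomial.isHomogeneous_X k 0⟩

/-- The tuple with its first entry specialized to `x_0`. -/
def specOne {r : ℕ} (g : Fin (r + 1) → Form k n 1) : Fin (r + 1) → Form k (n + 1) 1 :=
  Fin.cons (formX k n) (embedTuple (Fin.tail g))

/-- The tuple with its first two entries specialized to `x_0`. -/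
def specTwo {r : ℕ} (g : Fin (r + 1 + 1) → Form k n 1) : Fin (r + 1 + 1) → Form k (n + 1) 1 :=
  Fin.cons (formX k n) (specOne (Fin.tail g))

theorem omitProd_embedTuple {r : ℕ} (m : ℕ) (g : Fin r → Form k n 1) :
    omitProd m (embedTuple g) = embed k n (omitProd m g) := by
  rw [omitProd, omitProd, map_prod]
  rfl

theorem omitProd_zero_specOne {r : ℕ} (g : Fin (r + 1) → Form k n 1) :
    omitProd 0 (specOne g) = embed k n (omitProd 0 g) := by
  rw [omitProd_zero, omitProd_zero, map_prod]
  rfl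

theorem omitProd_succ_specOne {r : ℕ} (m : ℕ) (g : Fin (r + 1) → Form k n 1) :
    omitProd (m + 1) (specOne g) = MvPolynomial.X 0 * embed k n (omitProd m (Fin.tail g)) := by
  rw [omitProd_succ, ← omitProd_embedTuple]
  rfl

/-- The omitted position is always the first, so two entries are specialized in order that one
factor `x_0` survives. -/
theorem omitProd_zero_specTwo {r : ℕ} (g : Fin (r + 1 + 1) → Form k n 1) :
    omitProd 0 (specTwo g) = MvPolynomial.X 0 * embed k n (omitProd 0 (Fin.tail g)) := by
  rw [omitProd_zero, omitProd_zero, Fin.prod_univ_succ, map_prod]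
  rfl

/-- The sum `p + x_0 q + x_0² r`. -/
def layerSum (k : Type*) [Field k] (n : ℕ) :
    MvPolynomial (Fin (n + 1)) k × MvPolynomial (Fin (n + 1)) k × MvPolynomial (Fin (n + 1)) k →ₗ[k]
      MvPolynomial (Fin (n + 1 + 1)) k :=
  LinearMap.coprod (embed k n).toLinearMap
    (LinearMap.coprod ((LinearMap.mulLeft k (MvPolynomial.X 0)).comp (embed k n).toLinearMap)
      ((LinearMap.mulLeft k (MvPolynomial.X 0 ^ 2)).comp (embed k n).toLinearMap))

/-- The three summands are free of `x_0` up to the displayed powers, so they can be read off as the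
coefficients of a polynomial in `x_0`. -/
theorem layerSum_injective : Function.Injective (layerSum k n) := by
  have hC : ∀ p, MvPolynomial.finSuccEquiv k (n + 1) (embed k n p) = Polynomial.C p := by
    intro p
    induction p using MvPolynomial.induction_on with
    | C c => simp [MvPolynomial.finSuccEquiv_apply]
    | add p q hp hq => rw [map_add, map_add, hp, hq, map_add]
    | mul_X p i hp =>
      rw [map_mul, map_mul, hp, MvPolynomial.rename_X, MvPolynomial.finSuccEquiv_X_succ, map_mul]
  have key : ∀ p, MvPolynomial.finSuccEquiv k (n + 1) (layerSum k n p) =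
      Polynomial.C p.1 + Polynomial.C p.2.1 * Polynomial.X +
        Polynomial.C p.2.2 * Polynomial.X ^ 2 := by
    rintro ⟨p, q, r⟩
    simp only [layerSum, LinearMap.coprod_apply, LinearMap.comp_apply, AlgHom.toLinearMap_apply,
      LinearMap.mulLeft_apply, map_add, map_mul, map_pow, hC, MvPolynomial.finSuccEquiv_X_zero]
    ring
  rw [injective_iff_map_eq_zero]
  rintro ⟨p, q, r⟩ h
  have h1 := key (p, q, r)
  rw [h, map_zero] at h1
  have c0 := congrArg (fun P => Polynomial.coeff P 0) h1
  have c1 := congrArg (fun P => Polynomial.coeff P 1) h1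
  have c2 := congrArg (fun P => Polynomial.coeff P 2) h1
  simp [Polynomial.coeff_X, Polynomial.coeff_C] at c0 c1 c2
  simp [← c0, ← c1, ← c2]

variable {e s' s'' t' t'' u' u'' v' v'' : ℕ}

variable (k n e s' s'' t' t'' u' u'' v' v'') in
/-- Pairs of collections of tuples: those to be specialized and those not to be. -/
abbrev TuplePairs : Type _ := Tuples k n (e + 2) s' t' u' v' × Tuples k n (e + 2) s'' t'' u'' v''

/-- The specialized tuples. -/
def specTuples (w : TuplePairs k n e s' s'' t' t'' u' u'' v' v'') :
    Tuples k (n + 1) (e + 2) (s' + s'') (t' + t'') (u' + u'') (v' + v'') :=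
  (Fin.append (fun j => specOne (w.1.1 j)) (fun j => embedTuple (w.2.1 j)),
    Fin.append (fun j => specTwo (w.1.2.1 j)) (fun j => embedTuple (w.2.2.1 j)),
    Fin.append (fun j => specOne (w.1.2.2.1 j)) (fun j => embedTuple (w.2.2.2.1 j)),
    Fin.append (fun j => specTwo (w.1.2.2.2 j)) (fun j => embedTuple (w.2.2.2.2 j)))

/-- The tuples for the layer of degree `0` in `x_0`. -/
def layerZero : TuplePairs k n e s' s'' t' t'' u' u'' v' v'' →ₗ[k]
    Tuples k n (e + 2) s'' (t'' + u') u'' (s' + v'') where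
  toFun w := (w.2.1, Fin.append w.2.2.1 w.1.2.2.1, w.2.2.2.1, Fin.append w.1.1 w.2.2.2.2)
  map_add' a b := by
    refine Prod.ext rfl (Prod.ext (funext fun j => ?_) (Prod.ext rfl (funext fun j => ?_))) <;>
    refine Fin.addCases (fun j => ?_) (fun j => ?_) j <;> simp
  map_smul' c a := by
    refine Prod.ext rfl (Prod.ext (funext fun j => ?_) (Prod.ext rfl (funext fun j => ?_))) <;>
    refine Fin.addCases (fun j => ?_) (fun j => ?_) j <;> simp

/-- The tuples for the layer of degree `1` in `x_0`. -/
def layerOne : TuplePairs k n e s' s'' t' t'' u' u'' v' v'' →ₗ[k]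
    Tuples k n (e + 1) s' (t' + v'') (s'' + u') v' where
  toFun w := (fun j => Fin.tail (w.1.1 j),
    Fin.append (fun j => Fin.tail (w.1.2.1 j)) w.2.2.2.2,
    Fin.append w.2.1 (fun j => Fin.tail (w.1.2.2.1 j)),
    fun j => Fin.tail (w.1.2.2.2 j))
  map_add' a b := by
    refine Prod.ext rfl (Prod.ext (funext fun j => ?_) (Prod.ext (funext fun j => ?_) rfl)) <;>
    refine Fin.addCases (fun j => ?_) (fun j => ?_) j <;> simp <;> rfl
  map_smul' c a := by
    refine Prod.ext rfl (Prod.ext (funext fun j => ?_) (Prod.ext (funext fun j => ?_) rfl)) <;>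
    refine Fin.addCases (fun j => ?_) (fun j => ?_) j <;> simp <;> rfl

/-- The tuples for the layer of degree `2` in `x_0`. -/
def layerTwo : TuplePairs k n e s' s'' t' t'' u' u'' v' v'' →ₗ[k] Tuples k n e 0 v' s' 0 where
  toFun w := (0, fun j => Fin.tail (w.1.2.2.2 j), fun j => Fin.tail (w.1.1 j), 0)
  map_add' a b := Prod.ext (by simp) (Prod.ext rfl (Prod.ext rfl (by simp)))
  map_smul' c a := Prod.ext (by simp) (Prod.ext rfl (Prod.ext rfl (by simp)))

theorem append_castAdd_natAdd {α : Type*} {a b : ℕ} (f : Fin (a + b) → α) :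
    Fin.append (fun j => f (Fin.castAdd b j)) (fun j => f (Fin.natAdd a j)) = f :=
  funext fun j => Fin.addCases (fun j => by simp) (fun j => by simp) j

theorem layerZero_surjective :
    Function.Surjective (layerZero (k := k) (n := n) (e := e) (s' := s') (s'' := s'') (t' := t')
      (t'' := t'') (u' := u') (u'' := u'') (v' := v') (v'' := v'')) := by
  rintro ⟨a, b, c, d⟩
  -- Zeros fill the tuples that this layer does not see; below, `Fin.cons 0` likewise fills a first
  -- entry when only the tail enters.
  refine ⟨((fun j => d (Fin.castAdd v'' j), 0, fun j => b (Fin.natAdd t'' j), 0),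
    (a, fun j => b (Fin.castAdd u' j), c, fun j => d (Fin.natAdd s' j))), ?_⟩
  exact Prod.ext rfl (Prod.ext (append_castAdd_natAdd b) (Prod.ext rfl (append_castAdd_natAdd d)))

theorem layerOne_surjective :
    Function.Surjective (layerOne (k := k) (n := n) (e := e) (s' := s') (s'' := s'') (t' := t')
      (t'' := t'') (u' := u') (u'' := u'') (v' := v') (v'' := v'')) := by
  rintro ⟨a, b, c, d⟩
  refine ⟨((fun j => Fin.cons 0 (a j), fun j => Fin.cons 0 (b (Fin.castAdd v'' j)),
    fun j => Fin.cons 0 (c (Fin.natAdd s'' j)), fun j => Fin.cons 0 (d j)),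
    (fun j => c (Fin.castAdd u' j), 0, 0, fun j => b (Fin.natAdd t' j))), ?_⟩
  exact Prod.ext rfl (Prod.ext (append_castAdd_natAdd b) (Prod.ext (append_castAdd_natAdd c) rfl))

theorem layerTwo_surjective :
    Function.Surjective (layerTwo (k := k) (n := n) (e := e) (s' := s') (s'' := s'') (t' := t')
      (t'' := t'') (u' := u') (u'' := u'') (v' := v') (v'' := v'')) := by
  rintro ⟨a, b, c, d⟩
  exact ⟨((fun j => Fin.cons 0 (c j), 0, 0, fun j => Fin.cons 0 (b j)), 0),
    Prod.ext (Subsingleton.elim _ _) (Prod.ext rfl (Prod.ext rfl (Subsingleton.elim _ _)))⟩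

variable (w : TuplePairs k n e s' s'' t' t'' u' u'' v' v'')

/-- Layer 0 collects the generators free of `x_0`: those of unspecialized tuples with multipliers
free of `x_0`, and those of `s'` and `u'` tuples in which the entry `x_0` is the omitted one. -/
theorem embed_mem_spaceA {p : MvPolynomial (Fin (n + 1)) k} (hp : p ∈ spaceA (layerZero w)) :
    embed k n p ∈ spaceA (specTuples w) := by
  suffices h : spaceA (layerZero w) ≤ (spaceA (specTuples w)).comap (embed k n).toLinearMap from
    h hp
  refine spaceA_le (fun j m l => ?_) (fun j => ?_) (fun j m => ?_) (fun j l => ?_) <;>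
    simp only [Submodule.mem_comap, AlgHom.toLinearMap_apply, map_mul]
  · have h := mul_mem_spaceA_left (specTuples w) (Fin.natAdd s' j) m (embedForm l)
    simp only [specTuples, Fin.append_right, omitProd_embedTuple] at h ⊢
    exact h
  · refine Fin.addCases (fun j => ?_) (fun j => ?_) j
    · have h := omitProd_zero_mem_spaceA (specTuples w) (Fin.natAdd t' j)
      simp only [specTuples, layerZero, LinearMap.coe_mk, AddHom.coe_mk, Fin.append_left,
        Fin.append_right, omitProd_embedTuple] at h ⊢
      exact h
    · have h := omitProd_mem_spaceA (specTuples w) (Fin.castAdd u'' j) 0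
      simp only [specTuples, layerZero, LinearMap.coe_mk, AddHom.coe_mk, Fin.append_left,
        Fin.append_right, Fin.val_zero, omitProd_zero_specOne] at h ⊢
      exact h
  · have h := omitProd_mem_spaceA (specTuples w) (Fin.natAdd u' j) m
    simp only [specTuples, Fin.append_right, omitProd_embedTuple] at h ⊢
    exact h
  · refine Fin.addCases (fun j => ?_) (fun j => ?_) j
    · have h := mul_mem_spaceA_left (specTuples w) (Fin.castAdd s'' j) 0 (embedForm l)
      simp only [specTuples, layerZero, LinearMap.coe_mk, AddHom.coe_mk, Fin.append_left,
        Fin.val_zero, omitProd_zero_specOne] at h ⊢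
      exact h
    · have h := mul_mem_spaceA_right (specTuples w) (Fin.natAdd v' j) (embedForm l)
      simp only [specTuples, layerZero, LinearMap.coe_mk, AddHom.coe_mk,
        Fin.append_right, omitProd_embedTuple] at h ⊢
      exact h

/-- A single factor `x_0` arises in two ways: as a surviving entry of a specialized tuple, or as the
linear multiplier for the unspecialized `s''` and `v''` tuples. -/
theorem X_mul_embed_mem_spaceA {p : MvPolynomial (Fin (n + 1)) k} (hp : p ∈ spaceA (layerOne w)) :
    MvPolynomial.X 0 * embed k n p ∈ spaceA (specTuples w) := by
  suffices h : spaceA (layerOne w) ≤ (spaceA (specTuples w)).comap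
    ((LinearMap.mulLeft k (MvPolynomial.X 0)).comp (embed k n).toLinearMap) from h hp
  refine spaceA_le (fun j m l => ?_) (fun j => ?_) (fun j m => ?_) (fun j l => ?_) <;>
    simp only [Submodule.mem_comap, AlgHom.toLinearMap_apply, map_mul, LinearMap.comp_apply,
      LinearMap.mulLeft_apply, ← mul_assoc]
  · have h := mul_mem_spaceA_left (specTuples w) (Fin.castAdd s'' j) m.succ (embedForm l)
    simp only [specTuples, Fin.append_left, Fin.val_succ, omitProd_succ_specOne] at h ⊢
    exact h
  · refine Fin.addCases (fun j => ?_) (fun j => ?_) j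
    · have h := omitProd_zero_mem_spaceA (specTuples w) (Fin.castAdd t'' j)
      simp only [specTuples, layerOne, LinearMap.coe_mk, AddHom.coe_mk, Fin.append_left,
        omitProd_zero_specTwo] at h ⊢
      exact h
    · have h := mul_mem_spaceA_right (specTuples w) (Fin.natAdd v' j) (formX k n)
      rw [mul_comm]
      simp only [specTuples, layerOne, LinearMap.coe_mk, AddHom.coe_mk,
        Fin.append_right, omitProd_embedTuple] at h ⊢
      exact h
  · refine Fin.addCases (fun j => ?_) (fun j => ?_) j
    · have h := mul_mem_spaceA_left (specTuples w) (Fin.natAdd s' j) m (formX k n)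
      rw [mul_comm]
      simp only [specTuples, layerOne, LinearMap.coe_mk, AddHom.coe_mk, Fin.append_left,
        Fin.append_right, omitProd_embedTuple] at h ⊢
      exact h
    · have h := omitProd_mem_spaceA (specTuples w) (Fin.castAdd u'' j) m.succ
      simp only [specTuples, layerOne, LinearMap.coe_mk, AddHom.coe_mk, Fin.append_left,
        Fin.append_right, Fin.val_succ, omitProd_succ_specOne] at h ⊢
      exact h
  · have h := mul_mem_spaceA_right (specTuples w) (Fin.castAdd v'' j) (embedForm l)
    simp only [specTuples, Fin.append_left, omitProd_zero_specTwo] at h ⊢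
    exact h

/-- One factor `x_0` is a surviving specialized entry and the other is the linear multiplier, so
only the `s'` and `v'` tuples contribute. -/
theorem X_sq_mul_embed_mem_spaceA {p : MvPolynomial (Fin (n + 1)) k}
    (hp : p ∈ spaceA (layerTwo w)) :
    MvPolynomial.X 0 ^ 2 * embed k n p ∈ spaceA (specTuples w) := by
  suffices h : spaceA (layerTwo w) ≤ (spaceA (specTuples w)).comap
    ((LinearMap.mulLeft k (MvPolynomial.X 0 ^ 2)).comp (embed k n).toLinearMap) from h hp
  have hcomm : ∀ q : MvPolynomial (Fin (n + 1 + 1)) k,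
      MvPolynomial.X 0 ^ 2 * q = MvPolynomial.X 0 * q * MvPolynomial.X 0 := fun q => by ring
  refine spaceA_le (fun j => j.elim0) (fun j => ?_) (fun j m => ?_) (fun j => j.elim0) <;>
    simp only [Submodule.mem_comap, AlgHom.toLinearMap_apply, LinearMap.comp_apply,
      LinearMap.mulLeft_apply, hcomm]
  · have h := mul_mem_spaceA_right (specTuples w) (Fin.castAdd v'' j) (formX k n)
    simp only [specTuples, Fin.append_left, omitProd_zero_specTwo] at h ⊢
    exact h
  · have h := mul_mem_spaceA_left (specTuples w) (Fin.castAdd s'' j) m.succ (formX k n)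
    simp only [specTuples, Fin.append_left, Fin.val_succ, omitProd_succ_specOne] at h ⊢
    exact h

/-- The specialized space contains the direct sum of its three layers. -/
theorem finrank_layers_le :
    Module.finrank k (spaceA (layerZero w)) + (Module.finrank k (spaceA (layerOne w)) +
      Module.finrank k (spaceA (layerTwo w))) ≤ Module.finrank k (spaceA (specTuples w)) := by
  let Φ : spaceA (layerZero w) × spaceA (layerOne w) × spaceA (layerTwo w) →ₗ[k]
      MvPolynomial (Fin (n + 1 + 1)) k :=
    (layerSum k n).comp ((spaceA (layerZero w)).subtype.prodMap
      ((spaceA (layerOne w)).subtype.prodMap (spaceA (layerTwo w)).subtype))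
  have hΦ : Function.Injective Φ := layerSum_injective.comp
    ((Subtype.val_injective).prodMap (Subtype.val_injective.prodMap Subtype.val_injective))
  have hmem : ∀ x, Φ x ∈ spaceA (specTuples w) := fun x =>
    Submodule.add_mem _ (embed_mem_spaceA w x.1.2) (Submodule.add_mem _
      (X_mul_embed_mem_spaceA w x.2.1.2) (X_sq_mul_embed_mem_spaceA w x.2.2.2))
  have := LinearMap.finrank_le_finrank_of_injective (f := Φ.codRestrict _ hmem)
    (fun a b hab => hΦ (congrArg Subtype.val hab))
  rwa [Module.finrank_prod, Module.finrank_prod] at this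

theorem expA_layers :
    expA n (e + 2) s'' (t'' + u') u'' (s' + v'') + (expA n (e + 1) s' (t' + v'') (s'' + u') v' +
      expA n e 0 v' s' 0) = expA (n + 1) (e + 2) (s' + s'') (t' + t'') (u' + u'') (v' + v'') := by
  unfold expA
  ring

/-- The left side counts the monomials of degree `e + 2` whose degree in `x_0` is at most two. -/
theorem choose_layers_le :
    (n + (e + 2)).choose (e + 2) + ((n + (e + 1)).choose (e + 1) + (n + e).choose e) ≤
      (n + 1 + (e + 2)).choose (e + 2) := by
  have h1 : (n + 1 + (e + 2)).choose (e + 2) =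
      (n + (e + 2)).choose (e + 1) + (n + (e + 2)).choose (e + 2) := by
    rw [show n + 1 + (e + 2) = n + (e + 2) + 1 by ring]
    exact Nat.choose_succ_succ _ _
  have h2 : (n + (e + 2)).choose (e + 1) =
      (n + (e + 1)).choose e + (n + (e + 1)).choose (e + 1) :=
    Nat.choose_succ_succ (n + (e + 1)) e
  have h3 : (n + e).choose e ≤ (n + (e + 1)).choose e := Nat.choose_le_choose e (by omega)
  omega

/-- The splitting induction for the spaces of forms. -/
theorem isTrue_and_isSubabundant_of_layers [Infinite k]
    (h0 : IsTrue k n (e + 2) s'' (t'' + u') u'' (s' + v''))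
    (h0' : IsSubabundant n (e + 2) s'' (t'' + u') u'' (s' + v''))
    (h1 : IsTrue k n (e + 1) s' (t' + v'') (s'' + u') v')
    (h1' : IsSubabundant n (e + 1) s' (t' + v'') (s'' + u') v')
    (h2 : IsTrue k n e 0 v' s' 0) (h2' : IsSubabundant n e 0 v' s' 0) :
    IsTrue k (n + 1) (e + 2) (s' + s'') (t' + t'') (u' + u'') (v' + v'') ∧
      IsSubabundant (n + 1) (e + 2) (s' + s'') (t' + t'') (u' + u'') (v' + v'') := by
  have hsub : IsSubabundant (n + 1) (e + 2) (s' + s'') (t' + t'') (u' + u'') (v' + v'') := by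
    unfold IsSubabundant at *
    rw [← expA_layers]
    exact (Nat.add_le_add h0' (Nat.add_le_add h1' h2')).trans choose_layers_le
  refine ⟨?_, hsub⟩
  -- The layers share linear forms, so they cannot be chosen independently. Each condition is pulled
  -- back to the common parameter space, where the three generic conditions have a common point.
  obtain ⟨w, h0w, h1w, h2w⟩ := ((Generic.comap h0 layerZero layerZero_surjective).and
    ((Generic.comap h1 layerOne layerOne_surjective).and
      (Generic.comap h2 layerTwo (layerTwo_surjective (s'' := s'') (t' := t') (t'' := t'')
        (u' := u') (u'' := u'') (v'' := v''))))).exists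
  refine isTrue_of_exists (by omega) hsub (specTuples w) ?_
  have := finrank_layers_le w
  rw [h0w, h1w, h2w, min_eq_left h0', min_eq_left h1', min_eq_left h2', expA_layers] at this
  exact this

end Splitting

/-! ### Terracini's bound and nondefectivity -/

section Secant

variable {k : Type*} [Field k] {n d s : ℕ}

/-- The product of `d` linear forms, as a form of degree `d`. -/
def prodForm (l : Fin d → Form k n 1) : Form k n d :=
  ⟨∏ i, (l i).1, (MvPolynomial.mem_homogeneousSubmodule _ _).2 (by
    simpa using MvPolynomial.IsHomogeneous.prod Finset.univ (fun i => (l i).1) (fun _ => 1)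
      fun i _ => (l i).2)⟩

theorem coe_prodForm (l : Fin d → Form k n 1) :
    (prodForm l : MvPolynomial (Fin (n + 1)) k) = ∏ i, (l i).1 := rfl

/-- The sum of `s` products of `d` linear forms. -/
def sumProdForm (f : Fin s → Fin d → Form k n 1) : Form k n d := ∑ j, prodForm (f j)

/-- Components of polynomial maps to a space of forms are polynomial functions. -/
theorem IsPolyMap.exists_poly_form {V : Type*} [AddCommGroup V] [Module k V] {g : V → Form k n d}
    (hg : IsPolyMap (k := k) fun x => (g x).1) (φ : Module.Dual k (Form k n d)) :
    ∃ G : Poly k V, ∀ x, G.value x = φ (g x) := by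
  obtain ⟨ψ, rfl⟩ := LinearMap.exists_extend φ
  exact hg.exists_poly ψ

theorem isPolyMap_prodForm {V : Type*} [AddCommGroup V] [Module k V]
    (L : V →ₗ[k] (Fin d → Form k n 1)) : IsPolyMap (k := k) fun x => (prodForm (L x)).1 := by
  change IsPolyMap (k := k) fun x => ∏ i, (L x i).1
  exact IsPolyMap.prod _ fun i _ =>
    IsPolyMap.of_linear ((LinearMap.proj i).comp L) (Form k n 1).subtype

theorem isPolyMap_sumProdForm :
    IsPolyMap (k := k) fun f : Fin s → Fin d → Form k n 1 => (sumProdForm f).1 := by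
  have : (fun f : Fin s → Fin d → Form k n 1 => (sumProdForm f).1) =
      fun f => ∑ j, (prodForm (f j)).1 := by
    funext f
    rw [sumProdForm, Submodule.coe_sum]
  rw [this]
  exact IsPolyMap.sum _ fun j _ => isPolyMap_prodForm
    (LinearMap.proj j : (Fin s → Fin d → Form k n 1) →ₗ[k] (Fin d → Form k n 1))

theorem prodForm_smul (c : Fin d → k) (l : Fin d → Form k n 1) :
    prodForm (fun i => c i • l i) = (∏ i, c i) • prodForm l := by
  apply Subtype.ext
  simp only [coe_prodForm, Submodule.coe_smul, MvPolynomial.smul_eq_C_mul, map_prod,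
    Finset.prod_mul_distrib]

/-- Completely decomposable forms with a scalar and normalized linear factors as parameters. -/
def normalizedProd (x : Unit ⊕ (Fin d × Fin n) → k) : Form k n d :=
  x (.inl ()) • prodForm fun i => ⟨MvPolynomial.X 0, MvPolynomial.isHomogeneous_X k 0⟩ +
    ∑ j : Fin n, x (.inr (i, j)) • ⟨MvPolynomial.X j.succ, MvPolynomial.isHomogeneous_X k _⟩

theorem isPolyMap_normalizedProd :
    IsPolyMap (k := k) fun x => (normalizedProd (k := k) (n := n) (d := d) x).1 := by
  have hv : ∀ i : Unit ⊕ (Fin d × Fin n), ∀ b : MvPolynomial (Fin (n + 1)) k,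
      IsPolyMap (k := k) fun x : Unit ⊕ (Fin d × Fin n) → k => x i • b :=
    fun i b => IsPolyMap.dual_smul
      (LinearMap.proj i : (Unit ⊕ (Fin d × Fin n) → k) →ₗ[k] k) b
  have : (fun x => (normalizedProd (k := k) (n := n) (d := d) x).1) = fun x =>
      (x (.inl ()) • (1 : MvPolynomial (Fin (n + 1)) k)) * ∏ i : Fin d,
        (MvPolynomial.X 0 + ∑ j : Fin n, x (.inr (i, j)) • MvPolynomial.X j.succ) := by
    funext x
    simp [normalizedProd, coe_prodForm]
  rw [this]
  exact (hv _ _).mul (IsPolyMap.prod _ fun i _ => (IsPolyMap.const _).add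
    (IsPolyMap.sum _ fun j _ => hv _ _))

/-- The coefficient of `x_0`. -/
def coeffZero (k : Type*) [Field k] (n : ℕ) : Form k n 1 →ₗ[k] k :=
  (MvPolynomial.lcoeff k (Finsupp.single 0 1)).comp (Form k n 1).subtype

theorem eq_sum_of_form_one (l : Form k n 1) : ∃ x : Fin n → k, l =
    coeffZero k n l • ⟨MvPolynomial.X 0, MvPolynomial.isHomogeneous_X k 0⟩ +
      ∑ j : Fin n, x j • ⟨MvPolynomial.X j.succ, MvPolynomial.isHomogeneous_X k _⟩ := by
  have h : l.1 ∈ Submodule.span k (Set.range MvPolynomial.X) := by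
    rw [← MvPolynomial.homogeneousSubmodule_one_eq_span_X]
    exact l.2
  obtain ⟨c, hc⟩ := (Submodule.mem_span_range_iff_exists_fun k).1 h
  rw [Fin.sum_univ_succ] at hc
  have h0 : coeffZero k n l = c 0 := by
    simp only [coeffZero, LinearMap.comp_apply, Submodule.subtype_apply, MvPolynomial.lcoeff_apply,
      ← hc, MvPolynomial.coeff_add, MvPolynomial.coeff_sum, MvPolynomial.coeff_smul]
    simp [MvPolynomial.coeff_X, Finsupp.single_left_inj, Fin.succ_ne_zero]
  refine ⟨fun j => c j.succ, Subtype.ext ?_⟩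
  rw [h0]
  simpa using hc.symm

/-- A product of linear forms with nonzero coefficients of `x_0` can be normalized. -/
theorem prodForm_mem_range_normalizedProd {l : Fin d → Form k n 1}
    (hl : ∏ i, coeffZero k n (l i) ≠ 0) :
    prodForm l ∈ Set.range (normalizedProd (k := k) (n := n) (d := d)) := by
  choose x hx using fun i => eq_sum_of_form_one (l i)
  refine ⟨Sum.elim (fun _ => ∏ i, coeffZero k n (l i))
    (fun p => (coeffZero k n (l p.1))⁻¹ * x p.1 p.2), ?_⟩
  rw [normalizedProd, Sum.elim_inl, ← prodForm_smul]
  congr 1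
  funext i
  have hi : coeffZero k n (l i) ≠ 0 := Finset.prod_ne_zero_iff.1 hl i (Finset.mem_univ i)
  conv_rhs => rw [hx i]
  rw [smul_add, Finset.smul_sum]
  congr 1
  refine Finset.sum_congr rfl fun j _ => ?_
  rw [Sum.elim_inr, smul_smul, mul_inv_cancel_left₀ hi]

/-- Products whose factors all have nonzero `x_0`-coefficient can be normalized. These tuples form a
nonempty basic open set, which meets any set where a polynomial in the product is nonzero. -/
theorem vanishingIdeal_normalizedProd_le [Infinite k] :
    vanishingIdeal k (Set.range (normalizedProd (k := k) (n := n) (d := d))) ≤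
      vanishingIdeal k (Set.range (prodForm (k := k) (n := n) (d := d))) := by
  rintro F hF _ ⟨l, rfl⟩
  by_contra hne
  obtain ⟨H, hH⟩ := Poly.exists_comp (g := prodForm (k := k) (n := n) (d := d))
    (isPolyMap_prodForm LinearMap.id).exists_poly_form F
  let K : Poly k (Fin d → Form k n 1) :=
    ∏ i, MvPolynomial.X ((coeffZero k n).comp (LinearMap.proj i))
  have hK : ∀ l, K.value l = ∏ i, coeffZero k n (l i) := by
    intro l
    simp only [K, Poly.value, map_prod, MvPolynomial.eval_X]
    rfl
  obtain ⟨z, hz, hz'⟩ := Poly.exists_value_ne_zero_and (F := H) (G := K) (x := l)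
    (y := fun _ => ⟨MvPolynomial.X 0, MvPolynomial.isHomogeneous_X k 0⟩) (by rwa [hH])
    (by rw [hK]; simp [coeffZero])
  rw [hK] at hz'
  rw [hH] at hz
  exact hz (hF _ (prodForm_mem_range_normalizedProd hz'))

/-- Since `d ≥ 1`, the scalar relating two representatives of a class is absorbed into the first
factor, and the origin is the product of zero forms. -/
theorem affineCone_split_subset (hd : 1 ≤ d) :
    affineCone (Split k n d) ⊆ Set.range (prodForm (k := k) (n := n) (d := d)) := by
  rintro x (rfl | ⟨hx, f, hf, hmk, l, hl⟩)
  · refine ⟨0, Subtype.ext ?_⟩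
    exact Finset.prod_eq_zero (Finset.mem_univ (⟨0, hd⟩ : Fin d)) rfl
  · obtain ⟨a, rfl⟩ := (Projectivization.mk_eq_mk_iff k _ _ hx hf).1 hmk
    have hfl : f = prodForm l := Subtype.ext hl
    refine ⟨fun i => (if i = ⟨0, hd⟩ then (a : k) else 1) • l i, ?_⟩
    rw [prodForm_smul, hfl, Finset.prod_ite_eq' Finset.univ]
    simp
    rfl

/-- The affine cone over the variety of completely decomposable forms has dimension at most
`dn+1`. -/
theorem affineDim_affineCone_split_le [Infinite k] (hd : 1 ≤ d) :
    affineDim k (affineCone (Split k n d)) ≤ d * n + 1 := by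
  have h1 : affineDim k (affineCone (Split k n d)) ≤
      affineDim k (Set.range (normalizedProd (k := k) (n := n) (d := d))) := by
    refine affineDim_mono ⟨0, .inl rfl⟩ (vanishingIdeal_normalizedProd_le.trans ?_)
    exact fun F hF x hx => hF x (affineCone_split_subset hd hx)
  refine h1.trans ((affineDim_range_le fun φ => ?_).trans (by simp [add_comm]))
  obtain ⟨G, hG⟩ := isPolyMap_normalizedProd.exists_poly_form φ
  obtain ⟨P, hP⟩ := G.exists_eval_eq
  exact ⟨P, fun x => by rw [hP, hG]⟩

/-- The derivative of a sum of products in a single entry. -/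
theorem sumProdForm_add_smul_single (f : Fin s → Fin d → Form k n 1) (j : Fin s) (m : Fin d)
    (l : Form k n 1) (t : k) :
    (sumProdForm (f + t • (Pi.single j (Pi.single m l) : Fin s → Fin d → Form k n 1))).1 =
      (sumProdForm f).1 + t • (omitProd m (f j) * l.1) := by
  have h : ∀ i, (prodForm
      ((f + t • (Pi.single j (Pi.single m l) : Fin s → Fin d → Form k n 1)) i)).1 =
      (prodForm (f i)).1 + if i = j then t • (omitProd m (f j) * l.1) else 0 := by
    intro i
    split_ifs with hij
    · subst hij
      rw [coe_prodForm, coe_prodForm, ← omitProd_mul _ m, ← omitProd_mul (f i) m]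
      have : omitProd m
          ((f + t • (Pi.single i (Pi.single m l) : Fin s → Fin d → Form k n 1)) i) = omitProd m (f i) := by
        refine Finset.prod_congr rfl fun q hq => ?_
        have hq' : q ≠ m := fun h => (Finset.mem_filter.1 hq).2 (congrArg Fin.val h)
        simp [hq']
      rw [this]
      simp [mul_add]
    · simp [hij]
  simp only [sumProdForm, Submodule.coe_sum, h, Finset.sum_add_distrib, Finset.sum_ite_eq',
    Finset.mem_univ, if_true]

/-- Terracini's bound: the dimension of the set of sums of `s` products of linear forms is at least
the dimension of a sum of tangent spaces. -/
theorem finrank_spaceA_le_affineDim [CharZero k] (f : Tuples k n d s 0 0 0) :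
    Module.finrank k (spaceA f) ≤ affineDim k (Set.range (sumProdForm (k := k) (n := n) (d := d)
      (s := s))) := by
  rw [← span_spaceGen]
  obtain ⟨e, he⟩ := exists_fin_linearIndependent (k := k) fun i => spaceGen i f
  have gen : ∀ i, ∃ (j : Fin s) (m : Fin d) (l : Form k n 1),
      spaceGen i f = omitProd m (f.1 j) * l.1 := by
    rintro (⟨j, m, i⟩ | j | ⟨j, m⟩ | ⟨j, i⟩)
    · exact ⟨j, m, ⟨MvPolynomial.X i, MvPolynomial.isHomogeneous_X k i⟩, rfl⟩
    all_goals exact j.elim0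
  choose j m l hgen using fun q => gen (e q)
  let w : Fin _ → Fin s → Fin d → Form k n 1 :=
    fun q => Pi.single (j q) (Pi.single (m q) (l q))
  -- Along a change of a single entry the sum of products is affine-linear, so this difference is
  -- exactly the derivative.
  let T : Fin _ → Form k n d := fun q => sumProdForm (f.1 + w q) - sumProdForm f.1
  have hT : ∀ q, (T q).1 = spaceGen (e q) f := by
    intro q
    have := sumProdForm_add_smul_single f.1 (j q) (m q) (l q) 1
    rw [one_smul, one_smul] at this
    simp only [T, w, AddSubgroupClass.coe_sub, this, hgen, add_sub_cancel_left]
  have hline : ∀ q (t : k), sumProdForm (f.1 + t • w q) = sumProdForm f.1 + t • T q := by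
    intro q t
    apply Subtype.ext
    rw [Submodule.coe_add, Submodule.coe_smul, hT, hgen]
    exact sumProdForm_add_smul_single f.1 (j q) (m q) (l q) t
  refine le_affineDim_range_of_finite isPolyMap_sumProdForm.exists_poly_form f.1 w T ?_ ?_
  · refine LinearIndependent.of_comp (Form k n d).subtype ?_
    have : (fun q => (T q).1) = fun q => spaceGen (e q) f := funext hT
    change LinearIndependent k fun q => (T q).1
    rw [this]
    exact he
  · intro q φ
    refine ⟨Polynomial.C (φ (sumProdForm f.1)) + Polynomial.C (φ (T q)) * Polynomial.X,
      fun t => ?_, by simp [Polynomial.coeff_C]⟩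
    rw [hline, map_add, map_smul, smul_eq_mul, mul_comm t]
    simp

/-- Supplies a point of `Split` to stand in for summands that vanish and hence define no projective
point. -/
theorem prodForm_X_ne_zero :
    prodForm (fun _ : Fin d => (⟨MvPolynomial.X 0, MvPolynomial.isHomogeneous_X k 0⟩ :
      Form k n 1)) ≠ 0 := by
  intro h
  have := congrArg Subtype.val h
  rw [coe_prodForm] at this
  exact Finset.prod_ne_zero_iff.2 (fun _ _ => MvPolynomial.X_ne_zero 0) this

theorem mk_prodForm_mem_split {l : Fin d → Form k n 1} (h : prodForm l ≠ 0) :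
    Projectivization.mk k (prodForm l) h ∈ Split k n d :=
  ⟨prodForm l, h, rfl, l, rfl⟩

/-- Sums of `s` completely decomposable forms lie on the cone over the secant variety. -/
theorem range_sumProdForm_subset :
    Set.range (sumProdForm (k := k) (n := n) (d := d) (s := s)) ⊆
      affineCone (secantVariety s (Split k n d)) := by
  classical
  rintro _ ⟨f, rfl⟩
  by_cases hx : sumProdForm f = 0
  · exact .inl hx
  refine .inr ⟨hx, @subset_closure _ (projectiveZariski k (Form k n d)) _ _ ?_⟩
  let p : Fin s → ℙ k (Form k n d) := fun j =>
    if h : prodForm (f j) ≠ 0 then Projectivization.mk k _ h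
    else Projectivization.mk k _ prodForm_X_ne_zero
  refine Set.mem_iUnion₂.2 ⟨p, fun j => ?_, ?_⟩
  · simp only [p]
    split_ifs <;> exact mk_prodForm_mem_split _
  · change (Projectivization.mk k _ hx).submodule ≤ _
    rw [Projectivization.submodule_mk, Submodule.span_singleton_le_iff_mem]
    refine Submodule.sum_mem _ fun j _ => Submodule.mem_iSup_of_mem j ?_
    by_cases h : prodForm (f j) = 0
    · rw [h]
      exact zero_mem _
    · simp only [p, dif_pos h, Projectivization.submodule_mk]
      exact Submodule.mem_span_singleton_self _

/-- A sum of tangent spaces of the expected dimension forces nondefectivity. -/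
theorem secantNondefective_split [CharZero k] (hd : 1 ≤ d) (h : IsTrue k n d s 0 0 0)
    (hsub : IsSubabundant n d s 0 0 0) : SecantNondefective s (Split k n d) := by
  obtain ⟨f, hf⟩ := Generic.exists h
  rw [min_eq_left hsub] at hf
  have h1 := finrank_spaceA_le_affineDim f
  have h2 : affineDim k (Set.range (sumProdForm (k := k) (n := n) (d := d) (s := s))) ≤
      affineDim k (affineCone (secantVariety s (Split k n d))) :=
    affineDim_mono (Set.range_nonempty _) fun F hF x hx => hF x (range_sumProdForm_subset hx)
  have h3 := affineDim_affineCone_split_le (k := k) (n := n) hd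
  have h4 : expA n d s 0 0 0 = s * (d * n + 1) := by
    unfold expA
    ring
  have h5 := Nat.mul_le_mul_left s h3
  unfold SecantNondefective SecantDefective expectedDim projDim
  rw [not_lt]
  -- The bound `s(dn+1)` already dominates `s` times the dimension of the cone over `Split`, so the
  -- first term of the minimum suffices.
  refine (min_le_left _ _).trans ?_
  rw [sub_add_cancel]
  have h6 : s * affineDim k (affineCone (Split k n d)) ≤
      affineDim k (affineCone (secantVariety s (Split k n d))) := by omega
  have : ((s * affineDim k (affineCone (Split k n d)) : ℕ) : ℤ) ≤
      affineDim k (affineCone (secantVariety s (Split k n d))) := by exact_mod_cast h6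
  push_cast at this
  linarith

end Secant

end SplittingInduction

end

/-! ### The splitting induction theorem -/

theorem theorem3p2p1 (k : Type*) [Field k] [IsAlgClosed k] [CharZero k]
    (n d s t u v s' s'' t' t'' u' u'' v' v'' : ℕ)
    (hn : 2 ≤ n) (hd : 3 ≤ d)
    (hs : s = s' + s'') (ht : t = t' + t'') (hu : u = u' + u'') (hv : v = v' + v'')
    (h0 : IsTrue k (n - 1) d s'' (t'' + u') u'' (s' + v'') ∧
      IsSubabundant (n - 1) d s'' (t'' + u') u'' (s' + v''))
    (h1 : IsTrue k (n - 1) (d - 1) s' (t' + v'') (s'' + u') v' ∧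
      IsSubabundant (n - 1) (d - 1) s' (t' + v'') (s'' + u') v')
    (h2 : IsTrue k (n - 1) (d - 2) 0 v' s' 0 ∧
      IsSubabundant (n - 1) (d - 2) 0 v' s' 0) :
    (IsTrue k n d s t u v ∧ IsSubabundant n d s t u v) ∧
      (t = 0 → u = 0 → v = 0 → SecantNondefective s (Split k n d)) := by
  -- Writing `n` as `m + 1` and `d` as `e + 2` turns the truncated subtractions in the hypotheses
  -- into the layer parameters.
  obtain ⟨n, rfl⟩ : ∃ m, n = m + 1 := ⟨n - 1, by omega⟩
  obtain ⟨d, rfl⟩ : ∃ e, d = e + 2 := ⟨d - 2, by omega⟩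
  subst hs ht hu hv
  have h := isTrue_and_isSubabundant_of_layers h0.1 h0.2 h1.1 h1.2 h2.1 h2.2
  refine ⟨h, fun ht hu hv => ?_⟩
  rw [ht, hu, hv] at h
  exact secantNondefective_split (by omega) h.1 h.2
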